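/- Let $d\ge 1$, let $\Omega\subset\mathbb{R}^d$ be a Lebesgue measurable set of positive and finite measure, and let $L^p(\Omega)$ be the space of scalar-valued $p$-integrable functions on $\Omega$, where the scalar field is either $\mathbb{R}$ or $\mathbb{C}$. A system $\{(u_n,u_n^*)\}_{n=1}^\infty\subset X\times X^*$ in a Banach space $X$ with dual $X^*$ is an *unconditional Schauder frame* if every $x\in X$ satisfies $x=\sum_{n=1}^\infty u_n^*(x)\,u_n$ with an unconditionally convergent series. A system $\{u_n\}$ of vectors in a Banach space is *seminormalized* if there are constants $A,B>0$ such that $A\le\|u_n\|\le B$ for every $n$. (i) If $1<p\le 2$, then there is an unconditional Schauder frame $\{(g_n,g_n^*)\}_{n=1}^\infty$ in $L^p(\Omega)$ such that every $g_n$ is unimodular, i.e. $|g_n(x)|=1$ for a.e. $x\in\Omega$, and the system $\{g_n^*\}$ is seminormalized in $(L^p(\Omega))^*$. (ii) If $2<p<\infty$ and $\{(g_n,g_n^*)\}_{n=1}^\infty$ is an unconditional Schauder frame in $L^p(\Omega)$ such that $\{g_n\}$ is seminormalized in $L^p(\Omega)$ and uniformly bounded, i.e. there is a constant $M$ such that for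 every $n$ we have $|g_n(x)|\le M$ for a.e. $x\in\Omega$, then $\inf_n\|g_n^*\|=0$; consequently $\{g_n^*\}$ is not seminormalized. -/

import Mathlib

open MeasureTheory
open scoped ENNReal

/-- A system `(u n, u' n)` in `X × X*` is an unconditional Schauder frame if every `x` has the
expansion `x = ∑ u' n (x) u n`, the series converging unconditionally. Mathlib's `HasSum` is
convergence of the net of sums over finite sets of indices, i.e. unconditional convergence. -/
def IsUnconditionalSchauderFrame {𝕜 X : Type*} [RCLike 𝕜] [NormedAddCommGroup X]
    [NormedSpace 𝕜 X] (u : ℕ → X) (u' : ℕ → StrongDual 𝕜 X) : Prop :=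
  ∀ x : X, HasSum (fun n => u' n x • u n) x

/-- A system of vectors is seminormalized if its norms lie between two positive constants. -/
def IsSeminormalized {X : Type*} [NormedAddCommGroup X] (u : ℕ → X) : Prop :=
  ∃ A B : ℝ, 0 < A ∧ 0 < B ∧ ∀ n, A ≤ ‖u n‖ ∧ ‖u n‖ ≤ B

/-- The functions `g n` are unimodular: `|g n (x)| = 1` almost everywhere. -/
def IsUnimodularSystem {α 𝕜 : Type*} [MeasurableSpace α] [RCLike 𝕜] {p : ℝ≥0∞} {μ : Measure α}
    (g : ℕ → Lp 𝕜 p μ) : Prop :=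
  ∀ n, ∀ᵐ x ∂μ, ‖g n x‖ = 1

/-- The functions `g n` are uniformly bounded: there is one constant `M` with
`|g n (x)| ≤ M` almost everywhere, for every `n`. -/
def IsUniformlyBoundedSystem {α 𝕜 : Type*} [MeasurableSpace α] [RCLike 𝕜] {p : ℝ≥0∞}
    {μ : Measure α} (g : ℕ → Lp 𝕜 p μ) : Prop :=
  ∃ M : ℝ, ∀ n, ∀ᵐ x ∂μ, ‖g n x‖ ≤ M

/-! (i) A finite atomless measure on a standard Borel space is coded by the binary tree, so Haar
functions with values ±1 on a cell and 0 elsewhere are available. For 1 < p ≤ 2 their series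
converge unconditionally by Burkholder's inequality (`levelAvg_haarSum_transform_le`, transferred in
`norm_haar_transform_le`). They have two defects: they are not unimodular, and their coefficient
functionals are not bounded uniformly in the level.

The remedy is to repeat each Haar function of level n `K n` times and divide its functional by 4 `K
n` (`smallCoef`). To each copy is added s times a Rademacher function cut off on the cell (`noise`),
which makes it unimodular. To its functional is added t times a fixed multiple of a norm-one
functional (`unitCoef`), which bounds it from below. Expanding the product gives four series. Summed
over s, t = ±1, only `smallCoef` times Haar survives, and it reproduces f minus its mean.

Each of the four series must converge unconditionally: Small times Haar is Burkholder. Small times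
noise needs square summable coefficients, which follows from the cotype 2 estimate
`sum_sq_haarCoef_le` and `K n` ≥ 2^(2n/p). Unit times Haar has coefficients in ℓ^p and uses type p
together with `K n`^(p-1) ≤ 2·2^n. Unit times noise uses ℓ^p ⊂ ℓ^2. The two demands on `K n` are
compatible because 2/p ≤ 1/(p-1) for p ≤ 2.

(ii) Suppose the functionals are bounded below. Bounded functions that are large in L^p are large in
L^2, so averaging the frame expansion over signs makes the coefficients of f square summable
(`exists_sum_norm_coef_sq_le`). Type 2 of L^p, obtained from Khintchine's inequality, gives the dual
statement for the numbers h(g n) (`exists_sum_norm_apply_sq_le`). Together they make L^p isomorphic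
to a Hilbert space. For p > 2 this is refuted by signed sums of indicators of the 2^N cells of one
level. -/

/-! ### Averages over the levels of the binary tree. -/

/-- The mean of `F` over the `2 ^ n` vertices of level `n` of the binary tree. -/
noncomputable def levelAvg (n : ℕ) (F : ℕ → ℝ) : ℝ := (∑ k ∈ Finset.range (2 ^ n), F k) / 2 ^ n

theorem sum_range_two_mul {M : Type*} [AddCommMonoid M] (F : ℕ → M) (n : ℕ) :
    ∑ k ∈ Finset.range (2 * n), F k = ∑ k ∈ Finset.range n, (F (2 * k) + F (2 * k + 1)) := by
  induction n with
  | zero => simp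
  | succ n ih =>
    rw [Finset.sum_range_succ, ← ih, mul_add, mul_one, Finset.sum_range_succ,
      Finset.sum_range_succ, add_assoc]

theorem levelAvg_zero (F : ℕ → ℝ) : levelAvg 0 F = F 0 := by simp [levelAvg]

theorem levelAvg_succ (n : ℕ) (F : ℕ → ℝ) :
    levelAvg (n + 1) F = levelAvg n fun k => (F (2 * k) + F (2 * k + 1)) / 2 := by
  simp only [levelAvg, pow_succ', sum_range_two_mul]
  rw [← Finset.sum_div, div_div]

theorem levelAvg_mono {n : ℕ} {F G : ℕ → ℝ} (h : ∀ k < 2 ^ n, F k ≤ G k) :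
    levelAvg n F ≤ levelAvg n G := by
  unfold levelAvg
  gcongr with k hk
  exact h k (Finset.mem_range.1 hk)

theorem levelAvg_add (n : ℕ) (F G : ℕ → ℝ) :
    levelAvg n (fun k => F k + G k) = levelAvg n F + levelAvg n G := by
  simp only [levelAvg, Finset.sum_add_distrib, add_div]

theorem levelAvg_sub (n : ℕ) (F G : ℕ → ℝ) :
    levelAvg n (fun k => F k - G k) = levelAvg n F - levelAvg n G := by
  simp only [levelAvg, Finset.sum_sub_distrib, sub_div]

theorem levelAvg_const_mul (n : ℕ) (a : ℝ) (F : ℕ → ℝ) :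
    levelAvg n (fun k => a * F k) = a * levelAvg n F := by
  simp only [levelAvg, ← Finset.mul_sum, mul_div_assoc]

theorem levelAvg_const (n : ℕ) (a : ℝ) : levelAvg n (fun _ => a) = a := by
  simp [levelAvg]

theorem levelAvg_nonneg {n : ℕ} {F : ℕ → ℝ} (h : ∀ k, 0 ≤ F k) : 0 ≤ levelAvg n F :=
  div_nonneg (Finset.sum_nonneg fun k _ => h k) (by positivity)

theorem div_le_levelAvg {n k : ℕ} {F : ℕ → ℝ} (h : ∀ k, 0 ≤ F k) (hk : k < 2 ^ n) :
    F k / 2 ^ n ≤ levelAvg n F := by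
  unfold levelAvg
  gcongr
  exact Finset.single_le_sum (fun k _ => h k) (Finset.mem_range.2 hk)

/-! ### Haar polynomials on the tree and two-point inequalities. -/

section Haar

variable {𝕜 : Type*} [RCLike 𝕜]

/-- The Haar polynomial with coefficients `c n k`, as a function on the binary tree: its value at
the vertex `k` of level `n` uses the levels below `n`. -/
def haarSum (c : ℕ → ℕ → 𝕜) : ℕ → ℕ → 𝕜
  | 0, _ => 0
  | n + 1, k => haarSum c n (k / 2) + (-1) ^ k * c n (k / 2)

theorem haarSum_succ_two_mul (c : ℕ → ℕ → 𝕜) (n k : ℕ) :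
    haarSum c (n + 1) (2 * k) = haarSum c n k + c n k := by
  simp [haarSum]

theorem haarSum_succ_two_mul_add_one (c : ℕ → ℕ → 𝕜) (n k : ℕ) :
    haarSum c (n + 1) (2 * k + 1) = haarSum c n k - c n k := by
  have : (2 * k + 1) / 2 = k := by omega
  simp [haarSum, this, pow_succ, sub_eq_add_neg]

theorem norm_add_sq_add_norm_sub_sq (x d : 𝕜) :
    ‖x + d‖ ^ 2 + ‖x - d‖ ^ 2 = 2 * (‖x‖ ^ 2 + ‖d‖ ^ 2) := by
  have := parallelogram_law_with_norm 𝕜 x d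
  simp only [sq]
  linarith

/-- Orthogonality of martingale differences: the parallelogram law removes the cross terms at each
branching. -/
theorem levelAvg_haarSum_sq (c : ℕ → ℕ → 𝕜) (n : ℕ) :
    levelAvg n (fun k => ‖haarSum c n k‖ ^ 2) =
      ∑ l ∈ Finset.range n, levelAvg l fun k => ‖c l k‖ ^ 2 := by
  induction n with
  | zero => simp [levelAvg, haarSum]
  | succ n ih =>
    rw [Finset.sum_range_succ, ← ih, levelAvg_succ, ← levelAvg_add]
    congr 1
    ext k
    rw [haarSum_succ_two_mul, haarSum_succ_two_mul_add_one]
    linarith [norm_add_sq_add_norm_sub_sq (haarSum c n k) (c n k)]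

/-- Concavity of t^(p/2) applied to the parallelogram law, then subadditivity of t^(p/2). This is
the two-point form of type p. -/
theorem norm_add_rpow_add_norm_sub_rpow_le {p : ℝ} (hp : 0 < p) (hp2 : p ≤ 2) (x d : 𝕜) :
    ‖x + d‖ ^ p + ‖x - d‖ ^ p ≤ 2 * (‖x‖ ^ p + ‖d‖ ^ p) := by
  have key : ∀ t : ℝ, 0 ≤ t → t ^ p = (t ^ 2) ^ (p / 2) := fun t ht => by
    rw [← Real.rpow_natCast, ← Real.rpow_mul ht]
    congr 1
    push_cast
    ring
  have hhalf : (0 : ℝ) ≤ 1 / 2 := by norm_num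
  have h1 := (Real.concaveOn_rpow (p := p / 2) (by positivity) (by linarith)).2
    (Set.mem_Ici.2 (sq_nonneg ‖x + d‖)) (Set.mem_Ici.2 (sq_nonneg ‖x - d‖)) hhalf hhalf
    (by norm_num)
  simp only [smul_eq_mul, ← key _ (norm_nonneg _)] at h1
  rw [← mul_add, ← mul_add, norm_add_sq_add_norm_sub_sq] at h1
  have h2 := Real.rpow_add_le_add_rpow (p := p / 2) (sq_nonneg ‖x‖) (sq_nonneg ‖d‖)
    (by positivity) (by linarith)
  rw [← key _ (norm_nonneg _), ← key _ (norm_nonneg _)] at h2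
  have h3 : (1 / 2 : ℝ) * (2 * (‖x‖ ^ 2 + ‖d‖ ^ 2)) = ‖x‖ ^ 2 + ‖d‖ ^ 2 := by ring
  rw [h3] at h1
  linarith

theorem levelAvg_haarSum_rpow_le {p : ℝ} (hp : 0 < p) (hp2 : p ≤ 2) (c : ℕ → ℕ → 𝕜) (n : ℕ) :
    levelAvg n (fun k => ‖haarSum c n k‖ ^ p) ≤
      ∑ l ∈ Finset.range n, levelAvg l fun k => ‖c l k‖ ^ p := by
  induction n with
  | zero => simp [levelAvg, haarSum, hp.ne']
  | succ n ih =>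
    rw [Finset.sum_range_succ]
    refine le_trans ?_ (add_le_add_left ih _)
    rw [levelAvg_succ, ← levelAvg_add]
    refine levelAvg_mono fun k _ => ?_
    rw [haarSum_succ_two_mul, haarSum_succ_two_mul_add_one]
    linarith [norm_add_rpow_add_norm_sub_rpow_le hp hp2 (haarSum c n k) (c n k)]

/-- A quantitative form of the strict convexity of `r ^ p`. -/
theorem convexOn_rpow_sub_sq {p R : ℝ} (hp : 1 < p) (hp2 : p ≤ 2) (hR : 0 < R) :
    ConvexOn ℝ (Set.Icc 0 R) (fun r => r ^ p - p * (p - 1) / 2 * R ^ (p - 2) * r ^ 2) ∧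
    MonotoneOn (fun r => r ^ p - p * (p - 1) / 2 * R ^ (p - 2) * r ^ 2) (Set.Icc 0 R) := by
  set h : ℝ → ℝ := fun r => r ^ p - p * (p - 1) / 2 * R ^ (p - 2) * r ^ 2
  have hd : ∀ r, HasDerivAt h (p * r ^ (p - 1) - p * (p - 1) * R ^ (p - 2) * r) r := fun r => by
    have := (Real.hasDerivAt_rpow_const (x := r) (p := p) (Or.inr hp.le)).sub
      (((hasDerivAt_pow 2 r).const_mul (p * (p - 1) / 2 * R ^ (p - 2))))
    refine this.congr_deriv ?_
    push_cast
    ring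
  have hcont : Continuous h := continuous_iff_continuousAt.2 fun r => (hd r).continuousAt
  have hderiv : ∀ r, deriv h r = p * r ^ (p - 1) - p * (p - 1) * R ^ (p - 2) * r :=
    fun r => (hd r).deriv
  -- The second derivative is p(p-1)(r^(p-2) - R^(p-2)), which is nonnegative on (0, R] since p - 2
  -- ≤ 0.
  have hpow : ∀ r, 0 < r → r ≤ R → R ^ (p - 2) ≤ r ^ (p - 2) := fun r h0 h1 =>
    Real.rpow_le_rpow_of_nonpos h0 h1 (by linarith)
  constructor
  · refine MonotoneOn.convexOn_of_deriv (convex_Icc 0 R) hcont.continuousOn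
      (fun r _ => (hd r).differentiableAt.differentiableWithinAt) ?_
    rw [interior_Icc]
    refine monotoneOn_of_deriv_nonneg (convex_Ioo 0 R) ?_ ?_ ?_
    · rw [funext hderiv]
      intro r hr
      have : r ≠ 0 := hr.1.ne'
      fun_prop (disch := simp_all)
    · rw [funext hderiv, interior_Ioo]
      intro r hr
      have : r ≠ 0 := hr.1.ne'
      fun_prop (disch := simp_all)
    · rw [funext hderiv, interior_Ioo]
      intro r hr
      have h2 : HasDerivAt (fun r => p * r ^ (p - 1) - p * (p - 1) * R ^ (p - 2) * r)
          (p * (p - 1) * (r ^ (p - 2) - R ^ (p - 2))) r := by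
        have := ((Real.hasDerivAt_rpow_const (x := r) (p := p - 1) (Or.inl hr.1.ne')).const_mul
          p).sub ((hasDerivAt_id r).const_mul (p * (p - 1) * R ^ (p - 2)))
        refine this.congr_deriv ?_
        rw [show p - 1 - 1 = p - 2 by ring]
        ring
      rw [h2.deriv]
      have := hpow r hr.1 hr.2.le
      have : 0 < p * (p - 1) := by nlinarith
      nlinarith
  · refine monotoneOn_of_deriv_nonneg (convex_Icc 0 R) hcont.continuousOn
      (fun r _ => (hd r).differentiableAt.differentiableWithinAt) ?_
    rw [interior_Icc]
    intro r hr
    rw [hderiv]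
    have h1 : r ^ (p - 1) = r ^ (p - 2) * r := by
      rw [← Real.rpow_add_one hr.1.ne']
      congr 1
      ring
    have h2 := hpow r hr.1 hr.2.le
    have h3 : 0 ≤ R ^ (p - 2) := by positivity
    have h4 : (p - 1) * R ^ (p - 2) ≤ r ^ (p - 2) := by nlinarith
    rw [h1]
    have h5 : 0 ≤ p * r := mul_nonneg (by linarith) hr.1.le
    nlinarith

/-- Convexity and monotonicity of r^p minus a quadratic are applied to ‖x ± d‖, both at most R. The
parallelogram law evaluates the quadratic part exactly and leaves the gain in ‖d‖². -/
theorem rpow_norm_add_mul_sq_le {p R : ℝ} (hp : 1 < p) (hp2 : p ≤ 2) (hR : 0 < R) {x d : 𝕜}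
    (hxd : ‖x‖ + ‖d‖ ≤ R) :
    ‖x‖ ^ p + p * (p - 1) / 2 * (‖d‖ ^ 2 * R ^ (p - 2)) ≤ (‖x + d‖ ^ p + ‖x - d‖ ^ p) / 2 := by
  obtain ⟨hc, hm⟩ := convexOn_rpow_sub_sq hp hp2 hR
  have ha : ‖x + d‖ ∈ Set.Icc 0 R := ⟨norm_nonneg _, (norm_add_le _ _).trans hxd⟩
  have hb : ‖x - d‖ ∈ Set.Icc 0 R := ⟨norm_nonneg _, (norm_sub_le _ _).trans hxd⟩
  have hx : ‖x‖ ∈ Set.Icc 0 R := ⟨norm_nonneg _, by linarith [norm_nonneg d]⟩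
  have hhalf : (0 : ℝ) ≤ 1 / 2 := by norm_num
  have hmid := hc.2 ha hb hhalf hhalf (by norm_num)
  have hmem := (convex_Icc 0 R) ha hb hhalf hhalf (by norm_num)
  have hle : ‖x‖ ≤ (1 / 2 : ℝ) • ‖x + d‖ + (1 / 2 : ℝ) • ‖x - d‖ := by
    have h := norm_add_le (x + d) (x - d)
    rw [show x + d + (x - d) = (2 : 𝕜) * x by ring, norm_mul, RCLike.norm_ofNat] at h
    simp only [smul_eq_mul]
    linarith
  have h1 := hm hx hmem hle
  have h2 := h1.trans hmid
  simp only [smul_eq_mul] at h2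
  have h3 := norm_add_sq_add_norm_sub_sq x d
  have h4 : p * (p - 1) / 2 * R ^ (p - 2) * (‖x + d‖ ^ 2 + ‖x - d‖ ^ 2) =
    p * (p - 1) / 2 * R ^ (p - 2) * (2 * (‖x‖ ^ 2 + ‖d‖ ^ 2)) := by rw [h3]
  linarith

/-- Young's inequality. -/
theorem mul_rpow_sub_one_mul_le {p a t : ℝ} (hp : 1 < p) (ha : 0 ≤ a) (ht : 0 ≤ t) :
    p * (a ^ (p - 1) * t) ≤ (p - 1) * a ^ p + t ^ p := by
  have h := Real.geom_mean_le_arith_mean2_weighted (w₁ := (p - 1) / p) (w₂ := 1 / p)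
    (div_nonneg (by linarith) (by linarith)) (div_nonneg (by linarith) (by linarith))
    (Real.rpow_nonneg ha p) (Real.rpow_nonneg ht p) (by field_simp; ring)
  rw [← Real.rpow_mul ha, ← Real.rpow_mul ht, mul_div_cancel₀ _ (by linarith : p ≠ 0),
    mul_div_cancel₀ _ (by linarith : p ≠ 0), Real.rpow_one] at h
  calc p * (a ^ (p - 1) * t) ≤ p * ((p - 1) / p * a ^ p + 1 / p * t ^ p) := by gcongr
    _ = _ := by field_simp

end Haar

/-! ### Tree martingales: Doob's maximal inequality and Burkholder's inequality. -/

section Transform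

variable {𝕜 : Type*} [RCLike 𝕜]

/-- `f` is a martingale on the binary tree: the value at a vertex is the mean of the values at its
two children. -/
def IsTreeMartingale (f : ℕ → ℕ → 𝕜) : Prop :=
  ∀ n k, f n k = (f (n + 1) (2 * k) + f (n + 1) (2 * k + 1)) / 2

/-- The Haar coefficients of a function on the binary tree. -/
noncomputable def treeDiff (f : ℕ → ℕ → 𝕜) (n k : ℕ) : 𝕜 :=
  (f (n + 1) (2 * k) - f (n + 1) (2 * k + 1)) / 2

namespace IsTreeMartingale

variable {f : ℕ → ℕ → 𝕜} (hf : IsTreeMartingale f)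
include hf

theorem apply_two_mul (n k : ℕ) : f (n + 1) (2 * k) = f n k + treeDiff f n k := by
  rw [hf n k, treeDiff]
  ring

theorem apply_two_mul_add_one (n k : ℕ) : f (n + 1) (2 * k + 1) = f n k - treeDiff f n k := by
  rw [hf n k, treeDiff]
  ring

theorem apply_eq_add_haarSum (n k : ℕ) (hk : k < 2 ^ n) :
    f n k = f 0 0 + haarSum (treeDiff f) n k := by
  induction n generalizing k with
  | zero => simp_all [haarSum]
  | succ n ih =>
    have hk' : k / 2 < 2 ^ n := by
      rw [Nat.div_lt_iff_lt_mul two_pos, ← pow_succ]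
      exact hk
    rcases Nat.even_or_odd' k with ⟨j, rfl | rfl⟩
    · rw [hf.apply_two_mul, haarSum_succ_two_mul, ih j (by omega)]
      ring
    · rw [hf.apply_two_mul_add_one, haarSum_succ_two_mul_add_one, ih j (by omega)]
      ring

end IsTreeMartingale

/-- A predictable majorant of a function on the binary tree and of its differences. -/
noncomputable def predMax (f : ℕ → ℕ → 𝕜) : ℕ → ℕ → ℝ
  | 0, _ => 1
  | n + 1, k => max (predMax f n (k / 2)) (‖f n (k / 2)‖ + ‖treeDiff f n (k / 2)‖)

/-- The maximal function (bounded below by one) of a function on the binary tree. -/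
noncomputable def treeMax (f : ℕ → ℕ → 𝕜) : ℕ → ℕ → ℝ
  | 0, k => max 1 ‖f 0 k‖
  | n + 1, k => max (treeMax f n (k / 2)) ‖f (n + 1) k‖

theorem one_le_predMax (f : ℕ → ℕ → 𝕜) (n k : ℕ) : 1 ≤ predMax f n k := by
  induction n generalizing k with
  | zero => exact le_rfl
  | succ n ih => exact le_max_of_le_left (ih _)

theorem one_le_treeMax (f : ℕ → ℕ → 𝕜) (n k : ℕ) : 1 ≤ treeMax f n k := by
  induction n generalizing k with
  | zero => exact le_max_left _ _
  | succ n ih => exact le_max_of_le_left (ih _)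

theorem norm_le_treeMax (f : ℕ → ℕ → 𝕜) (n k : ℕ) : ‖f n k‖ ≤ treeMax f n k := by
  cases n <;> exact le_max_right _ _

theorem odd_div_two (k : ℕ) : (2 * k + 1) / 2 = k := by omega

theorem even_div_two (k : ℕ) : 2 * k / 2 = k := by omega

theorem predMax_succ_odd (f : ℕ → ℕ → 𝕜) (n k : ℕ) :
    predMax f (n + 1) (2 * k + 1) = predMax f (n + 1) (2 * k) := by
  simp only [predMax, odd_div_two, even_div_two]

theorem predMax_le_succ (f : ℕ → ℕ → 𝕜) (n k : ℕ) :
    predMax f n k ≤ predMax f (n + 1) (2 * k) := by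
  simp only [predMax, even_div_two]
  exact le_max_left _ _

theorem norm_add_norm_treeDiff_le (f : ℕ → ℕ → 𝕜) (n k : ℕ) :
    ‖f n k‖ + ‖treeDiff f n k‖ ≤ predMax f (n + 1) (2 * k) := by
  simp only [predMax, even_div_two]
  exact le_max_right _ _

/-- A difference is at most the norm at a child plus the norm at the parent, so the new entry of the
majorant is at most two parent values and one child value. -/
theorem predMax_le_three_mul {f : ℕ → ℕ → 𝕜} (hf : IsTreeMartingale f) (n k : ℕ) :
    predMax f n k ≤ 3 * treeMax f n k := by
  induction n generalizing k with
  | zero =>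
    have := one_le_treeMax f 0 k
    simp only [predMax]
    linarith
  | succ n ih =>
    have h1 : treeMax f n (k / 2) ≤ treeMax f (n + 1) k := le_max_left _ _
    have h2 : ‖f (n + 1) k‖ ≤ treeMax f (n + 1) k := le_max_right _ _
    have h3 := norm_le_treeMax f n (k / 2)
    have h4 : ‖treeDiff f n (k / 2)‖ ≤ ‖f (n + 1) k‖ + ‖f n (k / 2)‖ := by
      rcases Nat.even_or_odd' k with ⟨j, rfl | rfl⟩
      · rw [even_div_two, hf.apply_two_mul]
        calc ‖treeDiff f n j‖ = ‖f n j + treeDiff f n j - f n j‖ := by rw [add_sub_cancel_left]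
          _ ≤ _ := norm_sub_le _ _
      · rw [odd_div_two, hf.apply_two_mul_add_one]
        calc ‖treeDiff f n j‖ = ‖f n j - treeDiff f n j - f n j‖ := by
              rw [sub_sub_cancel_left, norm_neg]
          _ ≤ _ := norm_sub_le _ _
    refine max_le ((ih _).trans ?_) ?_ <;> linarith

/-- One step of Doob's maximal inequality. -/
theorem max_rpow_sub_le {p m s : ℝ} (hp : 1 < p) (hm : 0 ≤ m) (hs : 0 ≤ s) :
    (p - 1) * max m s ^ p - p * (max m s ^ (p - 1) * s) ≤
      (p - 1) * m ^ p - p * (m ^ (p - 1) * s) := by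
  rcases le_total s m with h | h
  · rw [max_eq_left h]
  · rw [max_eq_right h]
    -- When the maximum is s, the left side equals -s^p and the claim is exactly Young's inequality.
    have h1 := mul_rpow_sub_one_mul_le hp hm hs
    have h2 : s ^ (p - 1) * s = s ^ p := by
      rcases hs.eq_or_lt with rfl | h0
      · simp [(by linarith : p ≠ 0)]
      · rw [← Real.rpow_add_one h0.ne', sub_add_cancel]
    rw [h2]
    linarith

/-- The averaged expression decreases with n. Updating the maximum lowers it by `max_rpow_sub_le`;
the norm of f, which enters with a minus sign, only grows on average. The bound p - 1 comes from the
floor value 1 at the root. -/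
theorem levelAvg_treeMax_le {p : ℝ} (hp : 1 < p) {f : ℕ → ℕ → 𝕜} (hf : IsTreeMartingale f)
    (n : ℕ) :
    levelAvg n (fun k => (p - 1) * treeMax f n k ^ p - p * (treeMax f n k ^ (p - 1) * ‖f n k‖))
      ≤ p - 1 := by
  induction n with
  | zero =>
    rw [levelAvg_zero, treeMax]
    refine (max_rpow_sub_le hp zero_le_one (norm_nonneg _)).trans ?_
    simp only [Real.one_rpow]
    have := norm_nonneg (f 0 0)
    nlinarith
  | succ n ih =>
    refine le_trans ?_ ih
    rw [levelAvg_succ]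
    refine levelAvg_mono fun k _ => ?_
    have hm : 0 ≤ treeMax f n k := by linarith [one_le_treeMax f n k]
    simp only [treeMax, even_div_two, odd_div_two]
    have h0 := max_rpow_sub_le hp hm (norm_nonneg (f (n + 1) (2 * k)))
    have h1 := max_rpow_sub_le hp hm (norm_nonneg (f (n + 1) (2 * k + 1)))
    have h2 : ‖f n k‖ ≤ (‖f (n + 1) (2 * k)‖ + ‖f (n + 1) (2 * k + 1)‖) / 2 := by
      rw [hf n k, norm_div, RCLike.norm_ofNat]
      gcongr
      exact norm_add_le _ _
    have h3 : 0 ≤ p * treeMax f n k ^ (p - 1) := by positivity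
    have h4 := mul_le_mul_of_nonneg_left h2 h3
    linarith

theorem levelAvg_treeMax_rpow_le {p : ℝ} (hp : 1 < p) {f : ℕ → ℕ → 𝕜} (hf : IsTreeMartingale f)
    (n : ℕ) :
    levelAvg n (fun k => treeMax f n k ^ p) ≤
      2 + 2 ^ p / (p - 1) * levelAvg n fun k => ‖f n k‖ ^ p := by
  have h := levelAvg_treeMax_le hp hf n
  have h2 : levelAvg n (fun k => (p - 1) / 2 * treeMax f n k ^ p - 2 ^ p / 2 * ‖f n k‖ ^ p) ≤
      p - 1 := by
    refine le_trans (levelAvg_mono fun k _ => ?_) h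
    have hm : 0 ≤ treeMax f n k := by linarith [one_le_treeMax f n k]
    -- The factor 2 makes Young's inequality use up only half of (p - 1) times the power of the
    -- maximum.
    have := mul_rpow_sub_one_mul_le hp hm (t := 2 * ‖f n k‖) (by positivity)
    rw [Real.mul_rpow zero_le_two (norm_nonneg _)] at this
    linarith
  rw [levelAvg_sub, levelAvg_const_mul, levelAvg_const_mul] at h2
  have hp1 : 0 < p - 1 := by linarith
  rw [div_mul_eq_mul_div, ← sub_le_iff_le_add', le_div_iff₀ hp1]
  nlinarith

theorem levelAvg_predMax_rpow_le {p : ℝ} (hp : 1 < p) {f : ℕ → ℕ → 𝕜} (hf : IsTreeMartingale f)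
    (n : ℕ) :
    levelAvg n (fun k => predMax f n k ^ p) ≤
      3 ^ p * (2 + 2 ^ p / (p - 1) * levelAvg n fun k => ‖f n k‖ ^ p) := by
  refine le_trans (levelAvg_mono (G := fun k => 3 ^ p * treeMax f n k ^ p) fun k _ => ?_) ?_
  · have h1 := one_le_predMax f n k
    have h2 := one_le_treeMax f n k
    rw [← Real.mul_rpow (by norm_num) (by linarith)]
    exact Real.rpow_le_rpow (by linarith) (predMax_le_three_mul hf n k) (by linarith)
  · rw [levelAvg_const_mul]
    exact mul_le_mul_of_nonneg_left (levelAvg_treeMax_rpow_le hp hf n) (by positivity)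

/-- The majorant of level n + 1 has the same value at both children, so it can serve as R in the
two-point inequality. -/
theorem levelAvg_add_treeDiff_le {p : ℝ} (hp : 1 < p) (hp2 : p ≤ 2) {f : ℕ → ℕ → 𝕜}
    (hf : IsTreeMartingale f) (n : ℕ) :
    levelAvg n (fun k => ‖f n k‖ ^ p) + p * (p - 1) / 2 *
      levelAvg n (fun k => ‖treeDiff f n k‖ ^ 2 * predMax f (n + 1) (2 * k) ^ (p - 2)) ≤
    levelAvg (n + 1) (fun k => ‖f (n + 1) k‖ ^ p) := by
  rw [← levelAvg_const_mul, ← levelAvg_add, levelAvg_succ]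
  refine levelAvg_mono fun k _ => ?_
  rw [hf.apply_two_mul, hf.apply_two_mul_add_one]
  refine rpow_norm_add_mul_sq_le hp hp2 ?_ (norm_add_norm_treeDiff_le f n k)
  linarith [one_le_predMax f (n + 1) (2 * k)]

/-- The majorant grows along branches and p - 2 ≤ 0, so the weight only decreases and the square
already accumulated can be estimated with its old weight. The new square ‖c n k‖² is paid for by the
growth of the mean of ‖f‖^p. -/
theorem levelAvg_weighted_haarSum_le {p : ℝ} (hp : 1 < p) (hp2 : p ≤ 2) {f c : ℕ → ℕ → 𝕜}
    (hf : IsTreeMartingale f) (hc : ∀ n k, ‖c n k‖ ≤ ‖treeDiff f n k‖) (n : ℕ) :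
    p * (p - 1) / 2 * levelAvg n (fun k => ‖haarSum c n k‖ ^ 2 * predMax f n k ^ (p - 2)) ≤
      levelAvg n fun k => ‖f n k‖ ^ p := by
  have hp0 : 0 ≤ p * (p - 1) / 2 := by nlinarith
  induction n with
  | zero =>
    simp only [levelAvg_zero, haarSum, norm_zero]
    simp
    positivity
  | succ n ih =>
    refine le_trans ?_ (levelAvg_add_treeDiff_le hp hp2 hf n)
    refine le_trans ?_ (add_le_add_left ih _)
    rw [← mul_add, ← levelAvg_add]
    refine mul_le_mul_of_nonneg_left ?_ hp0
    rw [levelAvg_succ]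
    refine levelAvg_mono fun k _ => ?_
    rw [predMax_succ_odd, haarSum_succ_two_mul, haarSum_succ_two_mul_add_one, ← add_mul,
      norm_add_sq_add_norm_sub_sq]
    have h1 := one_le_predMax f n k
    have h2 := Real.rpow_le_rpow_of_nonpos (by linarith) (predMax_le_succ f n k)
      (by linarith : p - 2 ≤ 0)
    have h3 : 0 ≤ predMax f (n + 1) (2 * k) ^ (p - 2) :=
      Real.rpow_nonneg (by linarith [one_le_predMax f (n + 1) (2 * k)]) _
    have h4 : ‖c n k‖ ^ 2 ≤ ‖treeDiff f n k‖ ^ 2 := by gcongr; exact hc n k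
    have h5 := mul_le_mul_of_nonneg_right h4 h3
    have h6 := mul_le_mul_of_nonneg_left h2 (sq_nonneg ‖haarSum c n k‖)
    linarith

/-- Converts a weighted L² bound into an L^p bound: X^p suffices where g ≤ X, and g^(p-2) ≤ X^(p-2)
elsewhere. -/
theorem rpow_le_sq_mul_add {p g X : ℝ} (hp : 0 < p) (hp2 : p ≤ 2) (hg : 0 ≤ g) (hX : 0 < X) :
    g ^ p ≤ g ^ 2 * X ^ (p - 2) + X ^ p := by
  rcases le_total g X with h | h
  · have := Real.rpow_le_rpow hg h hp.le
    have : 0 ≤ g ^ 2 * X ^ (p - 2) := by positivity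
    linarith
  · have h1 := Real.rpow_le_rpow_of_nonpos hX h (by linarith : p - 2 ≤ 0)
    have h2 : g ^ p = g ^ 2 * g ^ (p - 2) := by
      rw [← Real.rpow_natCast, ← Real.rpow_add (hX.trans_le h)]
      congr 1
      push_cast
      ring
    have h3 := mul_le_mul_of_nonneg_left h1 (sq_nonneg g)
    have : 0 ≤ X ^ p := by positivity
    linarith

/-- **Burkholder's inequality** for dyadic martingales: multipliers of the Haar coefficients are
bounded in `L^p`. -/
theorem levelAvg_haarSum_transform_le {p : ℝ} (hp : 1 < p) (hp2 : p ≤ 2) :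
    ∃ C : ℝ, 0 < C ∧ ∀ f c : ℕ → ℕ → 𝕜, IsTreeMartingale f →
      (∀ n k, ‖c n k‖ ≤ ‖treeDiff f n k‖) → ∀ N, levelAvg N (fun k => ‖f N k‖ ^ p) ≤ 1 →
      levelAvg N (fun k => ‖haarSum c N k‖ ^ p) ≤ C := by
  have hp1 : 0 < p - 1 := by linarith
  have hp0 : 0 < p * (p - 1) / 2 := by positivity
  refine ⟨(p * (p - 1) / 2)⁻¹ + 3 ^ p * (2 + 2 ^ p / (p - 1)), by positivity, ?_⟩
  intro f c hf hc N hN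
  have h1 := levelAvg_weighted_haarSum_le hp hp2 hf hc N
  have h2 := levelAvg_predMax_rpow_le hp hf N
  have h3 : levelAvg N (fun k => ‖haarSum c N k‖ ^ p) ≤
      levelAvg N (fun k => ‖haarSum c N k‖ ^ 2 * predMax f N k ^ (p - 2)) +
      levelAvg N (fun k => predMax f N k ^ p) := by
    rw [← levelAvg_add]
    exact levelAvg_mono fun k _ => rpow_le_sq_mul_add (by linarith) hp2 (norm_nonneg _)
      (by linarith [one_le_predMax f N k])
  refine h3.trans (add_le_add ?_ (h2.trans ?_))
  · rw [← one_div, le_div_iff₀' hp0]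
    linarith
  · gcongr
    exact mul_le_of_le_one_right (by positivity) hN

/-- The Haar coefficients of a function bounded in `L^p` are square summable after
normalization in `L^p`. -/
theorem sum_sq_treeDiff_le {p : ℝ} (hp : 1 < p) (hp2 : p ≤ 2) :
    ∃ C : ℝ, 0 < C ∧ ∀ f : ℕ → ℕ → 𝕜, IsTreeMartingale f →
      ∀ N, levelAvg N (fun k => ‖f N k‖ ^ p) ≤ 1 →
      ∑ n ∈ Finset.range N, ∑ k ∈ Finset.range (2 ^ n),
        ((2 : ℝ) ^ n) ^ (-(2 / p)) * ‖treeDiff f n k‖ ^ 2 ≤ C := by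
  have hp1 : 0 < p - 1 := by linarith
  have hp0 : 0 < p * (p - 1) / 2 := by positivity
  set K : ℝ := 3 ^ p * (2 + 2 ^ p / (p - 1)) with hK
  have hK0 : 0 < K := by positivity
  refine ⟨(p * (p - 1) / 2)⁻¹ * K ^ ((2 - p) / p), by positivity, ?_⟩
  intro f hf N hN
  have hsum : ∀ M, levelAvg 0 (fun k => ‖f 0 k‖ ^ p) + p * (p - 1) / 2 * ∑ n ∈ Finset.range M,
      levelAvg n (fun k => ‖treeDiff f n k‖ ^ 2 * predMax f (n + 1) (2 * k) ^ (p - 2)) ≤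
      levelAvg M (fun k => ‖f M k‖ ^ p) := fun M => by
    induction M with
    | zero => simp
    | succ M ih =>
      rw [Finset.sum_range_succ, mul_add]
      linarith [levelAvg_add_treeDiff_le hp hp2 hf M]
  have hmono : Monotone fun M => levelAvg M (fun k => ‖f M k‖ ^ p) := by
    refine monotone_nat_of_le_succ fun n => le_trans ?_ (levelAvg_add_treeDiff_le hp hp2 hf n)
    refine le_add_of_nonneg_right (mul_nonneg hp0.le (levelAvg_nonneg fun k => ?_))
    have := one_le_predMax f (n + 1) (2 * k)
    positivity
  -- A single vertex in the averaged maximal bound gives X^p ≤ K·2^n for the majorant X. The power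
  -- -(2-p)/p of this bounds the weight X^(p-2) from below, and dividing by 2^n produces the
  -- exponent -2/p.
  have hX : ∀ n < N, ∀ k < 2 ^ n,
      ((2 : ℝ) ^ n) ^ (-(2 / p)) * K ^ (-((2 - p) / p)) ≤
        predMax f (n + 1) (2 * k) ^ (p - 2) / 2 ^ n := by
    intro n hn k hk
    have h0 := one_le_predMax f (n + 1) (2 * k)
    have hX0 : 0 < predMax f (n + 1) (2 * k) := by linarith
    have h1 : predMax f (n + 1) (2 * k) ^ p / 2 ^ n ≤ K := by
      have h2 : levelAvg (n + 1) (fun k => ‖f (n + 1) k‖ ^ p) ≤ 1 := (hmono hn).trans hN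
      refine le_trans ?_ ((levelAvg_predMax_rpow_le hp hf (n + 1)).trans ?_)
      · rw [levelAvg_succ]
        refine le_trans (le_of_eq ?_) (div_le_levelAvg (k := k) (fun j => ?_) hk)
        · rw [predMax_succ_odd]
          ring
        · have := one_le_predMax f (n + 1) (2 * j)
          have := one_le_predMax f (n + 1) (2 * j + 1)
          positivity
      · rw [hK]
        gcongr
        exact mul_le_of_le_one_right (by positivity) h2
    rw [div_le_iff₀ (by positivity)] at h1
    have h3 := Real.rpow_le_rpow_of_nonpos (by positivity) h1
      (by rw [neg_nonpos]; exact div_nonneg (by linarith) (by linarith) : -((2 - p) / p) ≤ 0)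
    rw [← Real.rpow_mul hX0.le, show p * -((2 - p) / p) = p - 2 by field_simp; ring,
      Real.mul_rpow hK0.le (by positivity)] at h3
    rw [le_div_iff₀ (by positivity)]
    refine le_trans (le_of_eq ?_) h3
    have h4 : ((2 : ℝ) ^ n) ^ (-(2 / p)) * 2 ^ n = ((2 : ℝ) ^ n) ^ (-((2 - p) / p)) := by
      rw [← Real.rpow_add_one (by positivity)]
      congr 1
      field_simp
      ring
    rw [← h4]
    ring
  have hfin : K ^ (-((2 - p) / p)) * ∑ n ∈ Finset.range N, ∑ k ∈ Finset.range (2 ^ n),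
      ((2 : ℝ) ^ n) ^ (-(2 / p)) * ‖treeDiff f n k‖ ^ 2 ≤ (p * (p - 1) / 2)⁻¹ := by
    rw [← one_div, le_div_iff₀' hp0]
    refine le_trans ?_ ((hsum N).trans hN)
    refine le_trans ?_ (le_add_of_nonneg_left (levelAvg_nonneg fun k => by positivity))
    refine mul_le_mul_of_nonneg_left ?_ hp0.le
    rw [Finset.mul_sum]
    refine Finset.sum_le_sum fun n hn => ?_
    rw [levelAvg, Finset.mul_sum, Finset.sum_div]
    refine Finset.sum_le_sum fun k hk => ?_
    have := mul_le_mul_of_nonneg_left (hX n (Finset.mem_range.1 hn) k (Finset.mem_range.1 hk))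
      (sq_nonneg ‖treeDiff f n k‖)
    calc _ = ‖treeDiff f n k‖ ^ 2 * (((2 : ℝ) ^ n) ^ (-(2 / p)) * K ^ (-((2 - p) / p))) := by ring
      _ ≤ _ := this
      _ = _ := by ring
  rw [Real.rpow_neg hK0.le, inv_mul_le_iff₀ (by positivity)] at hfin
  linarith

end Transform

/-! ### Dyadic codings of atomless finite measures. -/

section Coding

/-- A dyadic coding of a finite measure: `κ n x` is the index of the dyadic cell of level `n`
containing `x`. The `2 ^ n` cells of level `n` have equal measures, each of them is the union of
two cells of level `n + 1`, and the cells generate the `σ`-algebra up to null sets. -/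
structure IsDyadicCoding {α : Type*} [MeasurableSpace α] (μ : Measure α) (κ : ℕ → α → ℕ) :
    Prop where
  measurable : ∀ n, Measurable (κ n)
  lt : ∀ n x, κ n x < 2 ^ n
  half : ∀ n x, κ (n + 1) x / 2 = κ n x
  measureReal : ∀ n k, k < 2 ^ n → μ.real (κ n ⁻¹' {k}) = μ.real Set.univ / 2 ^ n
  generating : ∀ s, MeasurableSet s →
    ∃ t, MeasurableSet[⨆ n, MeasurableSpace.comap (κ n) ⊤] t ∧ s =ᵐ[μ] t

open ProbabilityTheory Filter Topology

theorem continuous_cdf (ν : Measure ℝ) [IsProbabilityMeasure ν] [NullSingletonClass ν] :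
    Continuous (cdf ν) := by
  refine continuous_iff_continuousAt.2 fun x => ?_
  rw [(monotone_cdf ν).continuousAt_iff_leftLim_eq_rightLim, StieltjesFunction.rightLim_eq]
  have h := (cdf ν).measure_singleton x
  rw [measure_cdf, measure_singleton] at h
  have h1 := (monotone_cdf ν).leftLim_le le_rfl (x := x)
  have h2 : cdf ν x - Function.leftLim (cdf ν) x ≤ 0 := ENNReal.ofReal_eq_zero.1 h.symm
  linarith

/-- The distribution function of an atomless probability measure is uniformly distributed. -/
theorem map_cdf_eq (ν : Measure ℝ) [IsProbabilityMeasure ν] [NullSingletonClass ν] :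
    ν.map (cdf ν) = volume.restrict (Set.Icc 0 1) := by
  have hm : Measurable (cdf ν) := (monotone_cdf ν).measurable
  have hval : ∀ t : ℝ, 0 < t → t < 1 → ∃ s, cdf ν s = t := fun t h0 h1 =>
    mem_range_of_exists_le_of_exists_ge (continuous_cdf ν)
      (((tendsto_cdf_atBot ν).eventually_lt_const h0).exists.imp fun _ h => h.le)
      (((tendsto_cdf_atTop ν).eventually_const_lt h1).exists.imp fun _ h => h.le)
  have : IsProbabilityMeasure (ν.map (cdf ν)) := Measure.isProbabilityMeasure_map hm.aemeasurable
  refine Measure.ext_of_Iic _ _ fun t => ?_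
  rw [Measure.map_apply hm measurableSet_Iic, Measure.restrict_apply measurableSet_Iic]
  rcases lt_or_ge t 0 with ht | ht
  · have h1 : cdf ν ⁻¹' Set.Iic t = ∅ := by
      ext s
      simpa using ht.trans_le (cdf_nonneg ν s)
    have h2 : Set.Iic t ∩ Set.Icc (0 : ℝ) 1 = ∅ := by
      ext s
      simp only [Set.mem_inter_iff, Set.mem_Iic, Set.mem_Icc, Set.mem_empty_iff_false, iff_false]
      intro h
      linarith [h.1, h.2.1]
    rw [h1, h2, measure_empty, measure_empty]
  rcases le_or_gt 1 t with ht1 | ht1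
  · have h1 : cdf ν ⁻¹' Set.Iic t = Set.univ := by
      ext s
      simpa using (cdf_le_one ν s).trans ht1
    have h2 : Set.Iic t ∩ Set.Icc (0 : ℝ) 1 = Set.Icc 0 1 :=
      Set.inter_eq_right.2 fun s hs => hs.2.trans ht1
    rw [h1, h2, measure_univ]
    simp
  have h2 : Set.Iic t ∩ Set.Icc (0 : ℝ) 1 = Set.Icc 0 t := by
    ext s
    simp only [Set.mem_inter_iff, Set.mem_Iic, Set.mem_Icc]
    constructor
    · exact fun h => ⟨h.2.1, h.1⟩
    · exact fun h => ⟨h.2, h.1, h.2.trans ht1.le⟩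
  rw [h2, Real.volume_Icc, sub_zero]
  apply le_antisymm
  -- The distribution function may be flat at height t, so the set is enclosed using values u > t,
  -- and then u decreases to t.
  · have h3 : ∀ u, t < u → u < 1 → ν (cdf ν ⁻¹' Set.Iic t) ≤ ENNReal.ofReal u := by
      intro u htu hu
      obtain ⟨s, hs⟩ := hval u (ht.trans_lt htu) hu
      rw [← hs, ofReal_cdf]
      refine measure_mono fun r hr => ?_
      by_contra hrs
      have := monotone_cdf ν (not_le.1 hrs).le
      have hr' : cdf ν r ≤ t := hr
      linarith
    have h4 : Tendsto (fun u => ENNReal.ofReal u) (𝓝[>] t) (𝓝 (ENNReal.ofReal t)) :=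
      (ENNReal.continuous_ofReal.tendsto t).mono_left nhdsWithin_le_nhds
    refine ge_of_tendsto h4 ?_
    filter_upwards [Ioo_mem_nhdsGT ht1] with u hu
    exact h3 u hu.1 hu.2
  · rcases ht.eq_or_lt with rfl | h0
    · simp
    · obtain ⟨s, hs⟩ := hval t h0 ht1
      nth_rw 1 [← hs]
      rw [ofReal_cdf]
      refine measure_mono fun r hr => ?_
      exact (monotone_cdf ν hr).trans hs.le

/-- An atomless probability space is coded by a uniformly distributed variable. -/
theorem exists_uniform_coding {α : Type*} [MeasurableSpace α] [StandardBorelSpace α]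
    (P : Measure α) [IsProbabilityMeasure P] [NullSingletonClass P] :
    ∃ U : α → ℝ, Measurable U ∧ (∀ x, U x ∈ Set.Ico (0 : ℝ) 1) ∧
      P.map U = volume.restrict (Set.Icc 0 1) ∧ ∀ s, MeasurableSet s →
        ∃ t, MeasurableSet[MeasurableSpace.comap U inferInstance] t ∧ s =ᵐ[P] t := by
  obtain ⟨φ, hφ⟩ := exists_measurableEmbedding_real α
  set ν := P.map φ with hν
  have : IsProbabilityMeasure ν := Measure.isProbabilityMeasure_map hφ.measurable.aemeasurable
  have : NullSingletonClass ν := ⟨fun x => by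
    rw [hφ.map_apply]
    exact (Set.subsingleton_singleton.preimage hφ.injective).measure_zero P⟩
  set F : α → ℝ := fun x => cdf ν (φ x) with hF
  have hcm : Measurable (cdf ν) := (monotone_cdf ν).measurable
  have hFm : Measurable F := hcm.comp hφ.measurable
  have hFmap : P.map F = volume.restrict (Set.Icc 0 1) := by
    rw [← map_cdf_eq ν, hν, Measure.map_map hcm hφ.measurable]
    rfl
  -- The value 1 occurs only on a null set. Moving it to 0 keeps the floor of 2^n U below 2^n
  -- everywhere.
  set U : α → ℝ := fun x => if F x < 1 then F x else 0 with hU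
  have hUm : Measurable U := Measurable.ite (measurableSet_lt hFm measurable_const) hFm
    measurable_const
  have hUF : U =ᵐ[P] F := by
    have h1 : P {x | ¬ F x < 1} = 0 := by
      have h2 : {x | ¬ F x < 1} = F ⁻¹' Set.Ici 1 := by
        ext x
        simp
      rw [h2, ← Measure.map_apply hFm measurableSet_Ici, hFmap,
        Measure.restrict_apply measurableSet_Ici]
      refine measure_mono_null (t := {1}) (fun x hx => ?_) (by simp)
      exact le_antisymm hx.2.2 hx.1
    have h3 : ∀ᵐ x ∂P, F x < 1 := h1
    filter_upwards [h3] with x hx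
    simp [hU, hx]
  have hUmap : P.map U = volume.restrict (Set.Icc 0 1) := by
    rw [Measure.map_congr hUF, hFmap]
  refine ⟨U, hUm, fun x => ?_, hUmap, fun s hs => ?_⟩
  · by_cases h : F x < 1
    · simpa [hU, h] using cdf_nonneg ν _
    · simp [hU, h]
  obtain ⟨s', hs', rfl⟩ : ∃ s', MeasurableSet s' ∧ φ ⁻¹' s' = s :=
    ⟨φ '' s, hφ.measurableSet_image.2 hs, Set.preimage_image_eq s hφ.injective⟩
  clear hs
  rw [BorelSpace.measurable_eq (α := ℝ), borel_eq_generateFrom_Iic] at hs'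
  -- Half-lines generate. The set φ ≤ a lies in F ≤ `cdf ν a`, and the larger set has no more
  -- measure, so the two agree almost everywhere.
  induction s', hs' using MeasurableSpace.generateFrom_induction with
  | hC s' h _ =>
    obtain ⟨a, rfl⟩ := h
    refine ⟨U ⁻¹' Set.Iic (cdf ν a), ⟨_, measurableSet_Iic, rfl⟩, ?_⟩
    have h1 : (U ⁻¹' Set.Iic (cdf ν a) : Set α) =ᵐ[P] F ⁻¹' Set.Iic (cdf ν a) := by
      filter_upwards [hUF] with x hx
      change (U x ≤ _) = (F x ≤ _)
      rw [hx]
    refine EventuallyEq.trans ?_ h1.symm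
    refine ae_eq_of_subset_of_measure_ge ?_ ?_
      (hφ.measurable measurableSet_Iic).nullMeasurableSet (measure_ne_top _ _)
    · exact fun x hx => monotone_cdf ν hx
    · rw [← Measure.map_apply hFm measurableSet_Iic, hFmap,
        ← Measure.map_apply hφ.measurable measurableSet_Iic, ← hν, ← ofReal_cdf ν a,
        Measure.restrict_apply measurableSet_Iic]
      refine (measure_mono (t := Set.Icc 0 (cdf ν a)) fun x hx => ⟨hx.2.1, hx.1⟩).trans ?_
      rw [Real.volume_Icc, sub_zero]
  | empty => exact ⟨∅, @MeasurableSet.empty _ (_), by simp⟩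
  | compl s' _ ih =>
    obtain ⟨t, ht, hst⟩ := ih
    exact ⟨tᶜ, ht.compl, by simpa using hst.compl⟩
  | iUnion s' _ ih =>
    choose t ht hst using ih
    refine ⟨⋃ n, t n, MeasurableSet.iUnion ht, ?_⟩
    rw [Set.preimage_iUnion]
    exact Filter.EventuallyEq.countable_iUnion hst

theorem measureReal_floor_preimage {α : Type*} [MeasurableSpace α] {P : Measure α} {U : α → ℝ}
    (hU : Measurable U) (hU0 : ∀ x, 0 ≤ U x) (hmap : P.map U = volume.restrict (Set.Icc 0 1))
    {n k : ℕ} (hk : k < 2 ^ n) :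
    P.real ((fun x => ⌊2 ^ n * U x⌋₊) ⁻¹' {k}) = 1 / 2 ^ n := by
  have h2 : (0 : ℝ) < 2 ^ n := by positivity
  have h1 : (fun x => ⌊2 ^ n * U x⌋₊) ⁻¹' {k} =
      U ⁻¹' Set.Ico ((k : ℝ) / 2 ^ n) ((k + 1 : ℝ) / 2 ^ n) := by
    ext x
    simp only [Set.mem_preimage, Set.mem_singleton_iff, Set.mem_Ico]
    rw [Nat.floor_eq_iff (mul_nonneg h2.le (hU0 x)), div_le_iff₀' h2, lt_div_iff₀' h2]
  rw [h1, measureReal_def, ← Measure.map_apply hU measurableSet_Ico, hmap,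
    Measure.restrict_apply measurableSet_Ico, Set.inter_eq_left.2, Real.volume_Ico,
    ENNReal.toReal_ofReal]
  · ring
  · rw [← sub_div]
    simp
  · intro x hx
    refine ⟨le_trans (by positivity) hx.1, hx.2.le.trans ?_⟩
    rw [div_le_one h2]
    exact_mod_cast hk

/-- Every atomless nonzero finite Borel measure has a dyadic coding. -/
theorem exists_isDyadicCoding {α : Type*} [MeasurableSpace α] [StandardBorelSpace α]
    (μ : Measure α) [IsFiniteMeasure μ] [NullSingletonClass μ] (hμ : μ ≠ 0) :
    ∃ κ : ℕ → α → ℕ, IsDyadicCoding μ κ := by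
  have h0 : μ Set.univ ≠ 0 := by simpa using hμ
  have htop : μ Set.univ ≠ ∞ := measure_ne_top _ _
  set P : Measure α := (μ Set.univ)⁻¹ • μ with hP
  have : IsProbabilityMeasure P := ⟨by simp [hP, ENNReal.inv_mul_cancel h0 htop]⟩
  have : NullSingletonClass P := ⟨fun x => by simp [hP]⟩
  have hμP : μ ≪ P := Measure.absolutelyContinuous_smul (by simp)
  obtain ⟨U, hUm, hU, hmap, hgen⟩ := exists_uniform_coding P
  refine ⟨fun n x => ⌊2 ^ n * U x⌋₊, ?_, ?_, ?_, ?_, ?_⟩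
  · exact fun n => Nat.measurable_floor.comp (hUm.const_mul _)
  · intro n x
    rw [Nat.floor_lt (mul_nonneg (by positivity) (hU x).1)]
    push_cast
    exact mul_lt_of_lt_one_right (by positivity) (hU x).2
  · intro n x
    rw [← Nat.floor_div_ofNat]
    congr 1
    ring
  · intro n k hk
    have h := measureReal_floor_preimage hUm (fun x => (hU x).1) hmap hk
    rw [hP, measureReal_ennreal_smul_apply, ENNReal.toReal_inv, ← measureReal_def] at h
    have hm : 0 < μ.real Set.univ := ENNReal.toReal_pos h0 htop
    rw [inv_mul_eq_iff_eq_mul₀ hm.ne'] at h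
    rw [h, mul_one_div]
  · intro s hs
    obtain ⟨t, ht, hst⟩ := hgen s hs
    refine ⟨t, ?_, hμP.ae_eq hst⟩
    refine (MeasurableSpace.comap_le_iff_le_map.2 ?_ : MeasurableSpace.comap U inferInstance ≤ _)
      t ht
    set m' : MeasurableSpace α :=
      ⨆ n, MeasurableSpace.comap (fun x => ⌊2 ^ n * U x⌋₊) ⊤ with hm'
    have hκ : ∀ n : ℕ, Measurable[m'] fun x => ⌊2 ^ n * U x⌋₊ := fun n =>
      Measurable.mono (comap_measurable _) (le_iSup (fun n : ℕ =>
        MeasurableSpace.comap (fun x => ⌊2 ^ n * U x⌋₊) ⊤) n) le_rfl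
    -- U is recovered as the limit of its dyadic truncations, so the cells generate everything that
    -- U does.
    have hlim : Measurable[m'] U := by
      refine @measurable_of_tendsto_metrizable α ℝ m' _ _ _ _
        (fun (n : ℕ) x => (⌊2 ^ n * U x⌋₊ : ℝ) / 2 ^ n) U
        (fun n => ((measurable_from_top (f := fun k : ℕ => (k : ℝ))).comp (hκ n)).div_const _) ?_
      refine tendsto_pi_nhds.2 fun x => ?_
      have h := (tendsto_nat_floor_mul_div_atTop (hU x).1).comp
        (tendsto_pow_atTop_atTop_of_one_lt (one_lt_two (α := ℝ)))
      refine h.congr fun n => ?_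
      simp [mul_comm]
    intro v hv
    exact hlim hv

end Coding

/-! ### Norms in L^p as integrals. -/

section LpNorm

variable {α E : Type*} [MeasurableSpace α] {μ : Measure α} [NormedAddCommGroup E] {p : ℝ≥0∞}

theorem norm_rpow_eq_integral (hp0 : p ≠ 0) (hp : p ≠ ∞) (f : Lp E p μ) :
    ‖f‖ ^ p.toReal = ∫ x, ‖f x‖ ^ p.toReal ∂μ := by
  have h0 : 0 ≤ ∫ x, ‖f x‖ ^ p.toReal ∂μ := integral_nonneg fun x => by positivity
  rw [Lp.norm_def, (Lp.memLp f).eLpNorm_eq_integral_rpow_norm hp0 hp,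
    ENNReal.toReal_ofReal (by positivity), ← Real.rpow_mul h0,
    inv_mul_cancel₀ (ENNReal.toReal_pos hp0 hp).ne', Real.rpow_one]

theorem integrable_norm_rpow_coe (hp0 : p ≠ 0) (hp : p ≠ ∞) (f : Lp E p μ) :
    Integrable (fun x => ‖f x‖ ^ p.toReal) μ :=
  (Lp.memLp f).integrable_norm_rpow hp0 hp

end LpNorm

/-! ### Step functions and Haar functions in L^p, and density of step functions. -/

namespace IsDyadicCoding

variable {α 𝕜 : Type*} [MeasurableSpace α] [RCLike 𝕜] {μ : Measure α} [IsFiniteMeasure μ]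
  {κ : ℕ → α → ℕ} (hκ : IsDyadicCoding μ κ) {p : ℝ≥0∞}

include hκ

omit [IsFiniteMeasure μ] in
theorem measurableSet_cell (n k : ℕ) : MeasurableSet (κ n ⁻¹' {k}) :=
  hκ.measurable n (measurableSet_singleton k)

omit [IsFiniteMeasure μ] in
theorem div_two_pow (N d : ℕ) (x : α) : κ (N + d) x / 2 ^ d = κ N x := by
  induction d with
  | zero => simp
  | succ d ih =>
    rw [← ih, ← hκ.half (N + d) x, Nat.div_div_eq_div_mul, pow_succ', add_assoc]

omit [IsFiniteMeasure μ] in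
theorem div_two_pow_of_le {N M : ℕ} (h : N ≤ M) (x : α) : κ M x / 2 ^ (M - N) = κ N x := by
  obtain ⟨d, rfl⟩ := Nat.exists_eq_add_of_le h
  rw [Nat.add_sub_cancel_left, hκ.div_two_pow]

omit [IsFiniteMeasure μ] in
theorem setIntegral_cell {E : Type*} [NormedAddCommGroup E] [NormedSpace ℝ E] {G : α → E}
    (hG : Integrable G μ) (n k : ℕ) : ∫ x in κ n ⁻¹' {k}, G x ∂μ =
      (∫ x in κ (n + 1) ⁻¹' {2 * k}, G x ∂μ) + ∫ x in κ (n + 1) ⁻¹' {2 * k + 1}, G x ∂μ := by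
  rw [← setIntegral_union _ (hκ.measurableSet_cell _ _) hG.integrableOn hG.integrableOn]
  · congr 2
    ext x
    simp only [Set.mem_preimage, Set.mem_singleton_iff, Set.mem_union, ← hκ.half n x]
    omega
  · rw [Set.disjoint_left]
    simp only [Set.mem_preimage, Set.mem_singleton_iff]
    omega

omit [IsFiniteMeasure μ] in
theorem integral_eq_sum_cell {E : Type*} [NormedAddCommGroup E] [NormedSpace ℝ E] {G : α → E}
    (hG : Integrable G μ) (n : ℕ) :
    ∫ x, G x ∂μ = ∑ k ∈ Finset.range (2 ^ n), ∫ x in κ n ⁻¹' {k}, G x ∂μ := by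
  rw [← integral_biUnion_finset _ (fun k _ => hκ.measurableSet_cell n k) _
    fun k _ => hG.integrableOn]
  · rw [← setIntegral_univ]
    congr 2
    ext x
    simp [hκ.lt n x]
  · intro i _ j _ hij
    rw [Function.onFun, Set.disjoint_left]
    intro x hx hx'
    exact hij (hx.symm.trans hx')

omit [IsFiniteMeasure μ] in
theorem setIntegral_comp {E : Type*} [NormedAddCommGroup E] [NormedSpace ℝ E] [CompleteSpace E]
    (F : ℕ → E) {n k : ℕ} (hk : k < 2 ^ n) :
    ∫ x in κ n ⁻¹' {k}, F (κ n x) ∂μ = (μ.real Set.univ / 2 ^ n) • F k := by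
  rw [setIntegral_congr_fun (g := fun _ => F k) (hκ.measurableSet_cell n k) fun x hx => by
    rw [show κ n x = k from hx], setIntegral_const, hκ.measureReal n k hk]

theorem memLp_comp {E : Type*} [NormedAddCommGroup E] (F : ℕ → E) (n : ℕ) :
    MemLp (fun x => F (κ n x)) p μ := by
  refine MemLp.of_bound (StronglyMeasurable.comp_measurable
    (StronglyMeasurable.of_discrete (f := F)) (hκ.measurable n)).aestronglyMeasurable
    (∑ k ∈ Finset.range (2 ^ n), ‖F k‖) (Filter.Eventually.of_forall fun x => ?_)
  exact Finset.single_le_sum (f := fun k => ‖F k‖) (fun k _ => norm_nonneg _)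
    (Finset.mem_range.2 (hκ.lt n x))

theorem integral_comp_eq_levelAvg (F : ℕ → ℝ) (n : ℕ) :
    ∫ x, F (κ n x) ∂μ = μ.real Set.univ * levelAvg n F := by
  rw [hκ.integral_eq_sum_cell (memLp_one_iff_integrable.1 (hκ.memLp_comp F n)) n, levelAvg,
    mul_div_assoc', Finset.mul_sum, Finset.sum_div]
  refine Finset.sum_congr rfl fun k hk => ?_
  rw [hκ.setIntegral_comp F (Finset.mem_range.1 hk), smul_eq_mul, div_mul_eq_mul_div]

variable (p 𝕜) in
/-- The step functions of level `n`, as elements of `L^p`. -/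
noncomputable def step (n : ℕ) : (ℕ → 𝕜) →ₗ[𝕜] Lp 𝕜 p μ where
  toFun c := (hκ.memLp_comp c n).toLp _
  map_add' _ _ := rfl
  map_smul' _ _ := rfl

theorem coeFn_step (n : ℕ) (c : ℕ → 𝕜) : hκ.step 𝕜 p n c =ᵐ[μ] fun x => c (κ n x) :=
  (hκ.memLp_comp c n).coeFn_toLp

theorem step_congr {n m : ℕ} {c c' : ℕ → 𝕜} (h : ∀ x, c (κ n x) = c' (κ m x)) :
    hκ.step 𝕜 p n c = hκ.step 𝕜 p m c' :=
  MemLp.toLp_congr (hκ.memLp_comp c n) (hκ.memLp_comp c' m) (Filter.Eventually.of_forall h)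

theorem step_congr_of_lt {n : ℕ} {c c' : ℕ → 𝕜} (h : ∀ k < 2 ^ n, c k = c' k) :
    hκ.step 𝕜 p n c = hκ.step 𝕜 p n c' :=
  hκ.step_congr fun x => h _ (hκ.lt n x)

theorem step_eq_succ (n : ℕ) (c : ℕ → 𝕜) :
    hκ.step 𝕜 p n c = hκ.step 𝕜 p (n + 1) fun k => c (k / 2) :=
  hκ.step_congr fun x => by rw [hκ.half]

theorem norm_step_rpow (hp0 : p ≠ 0) (hp : p ≠ ∞) (n : ℕ) (c : ℕ → 𝕜) :
    ‖hκ.step 𝕜 p n c‖ ^ p.toReal =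
      μ.real Set.univ * levelAvg n fun k => ‖c k‖ ^ p.toReal := by
  rw [norm_rpow_eq_integral hp0 hp, ← hκ.integral_comp_eq_levelAvg]
  refine integral_congr_ae ?_
  filter_upwards [hκ.coeFn_step (p := p) n c] with x hx
  rw [hx]

variable (p 𝕜) in
/-- The Haar function supported on the cell `i` of level `n`. -/
noncomputable def haar (n i : ℕ) : Lp 𝕜 p μ :=
  hκ.step 𝕜 p (n + 1) fun k => if k / 2 = i then (-1) ^ k else 0

theorem sum_smul_haar_level (c : ℕ → 𝕜) (n : ℕ) :
    ∑ i ∈ Finset.range (2 ^ n), c i • hκ.haar 𝕜 p n i =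
      hκ.step 𝕜 p (n + 1) fun k => (-1) ^ k * c (k / 2) := by
  simp only [haar, ← map_smul]
  rw [← map_sum]
  refine hκ.step_congr_of_lt fun k hk => ?_
  have hk2 : k / 2 < 2 ^ n := by
    rw [Nat.div_lt_iff_lt_mul two_pos, ← pow_succ]
    exact hk
  rw [Finset.sum_apply, Finset.sum_eq_single_of_mem (k / 2) (Finset.mem_range.2 hk2)]
  · simp [mul_comm]
  · intro i _ hi
    simp [hi.symm]

/-- The bridge from L^p to the tree: norms of finite Haar sums become level averages of `haarSum`.
-/
theorem sum_smul_haar (c : ℕ → ℕ → 𝕜) (N : ℕ) :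
    ∑ n ∈ Finset.range N, ∑ i ∈ Finset.range (2 ^ n), c n i • hκ.haar 𝕜 p n i =
      hκ.step 𝕜 p N (haarSum c N) := by
  induction N with
  | zero =>
    have : haarSum c 0 = 0 := rfl
    rw [this, map_zero, Finset.sum_range_zero]
  | succ N ih =>
    rw [Finset.sum_range_succ, ih, hκ.sum_smul_haar_level, hκ.step_eq_succ, ← map_add]
    rfl

theorem norm_sum_smul_haar_rpow (hp0 : p ≠ 0) (hp : p ≠ ∞) (c : ℕ → ℕ → 𝕜) (N : ℕ) :
    ‖∑ n ∈ Finset.range N, ∑ i ∈ Finset.range (2 ^ n), c n i • hκ.haar 𝕜 p n i‖ ^ p.toReal =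
      μ.real Set.univ * levelAvg N fun k => ‖haarSum c N k‖ ^ p.toReal := by
  rw [hκ.sum_smul_haar, hκ.norm_step_rpow hp0 hp]

/-- A π-λ argument on indicators. Level sets of the codings form a π-system, since two of them can
be described at the larger of their levels. Complements use linearity, and disjoint unions use
closedness of S. -/
theorem dense_step [Fact (1 ≤ p)] (hp : p ≠ ∞) (S : Submodule 𝕜 (Lp 𝕜 p μ))
    (hS : IsClosed (S : Set (Lp 𝕜 p μ))) (h : ∀ n c, hκ.step 𝕜 p n c ∈ S) (f : Lp 𝕜 p μ) :
    f ∈ S := by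
  classical
  have hle : (⨆ n, MeasurableSpace.comap (κ n) ⊤) ≤ ‹MeasurableSpace α› :=
    iSup_le fun n => (hκ.measurable n).comap_le
  have hcell : ∀ t (ht : MeasurableSet[⨆ n, MeasurableSpace.comap (κ n) ⊤] t) (a : 𝕜),
      indicatorConstLp p (hle t ht) (measure_ne_top μ t) a ∈ S := by
    intro t ht a
    induction t, ht using MeasurableSpace.induction_on_inter
      (MeasurableSpace.measurableSpace_iSup_eq _) with
    | h_inter =>
      rintro s ⟨n, A, -, rfl⟩ t ⟨m, B, -, rfl⟩ -
      refine ⟨max n m, {k | k / 2 ^ (max n m - n) ∈ A ∧ k / 2 ^ (max n m - m) ∈ B}, trivial, ?_⟩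
      ext x
      simp only [Set.mem_preimage, Set.mem_ofPred_eq, Set.mem_inter_iff,
        hκ.div_two_pow_of_le (le_max_left n m), hκ.div_two_pow_of_le (le_max_right n m)]
    | empty =>
      rw [indicatorConstLp_empty]
      exact S.zero_mem
    | basic t ht =>
      obtain ⟨n, A, -, rfl⟩ := ht
      convert h n (A.indicator fun _ => a) using 1
      refine MemLp.toLp_congr _ (hκ.memLp_comp _ n) (Filter.Eventually.of_forall fun x => ?_)
      by_cases hx : κ n x ∈ A <;> simp [hx]
    | compl t ht ih =>
      have h1 := indicatorConstLp_disjoint_union (p := p) (hle t ht) (hle t ht).compl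
        (measure_ne_top μ t) (measure_ne_top μ tᶜ) disjoint_compl_right a
      have h2 : indicatorConstLp p MeasurableSet.univ (measure_ne_top μ Set.univ) a ∈ S := by
        convert h 0 (fun _ => a) using 1
        rw [indicatorConstLp_univ]
        rfl
      have h3 : indicatorConstLp p ((hle t ht).union (hle t ht).compl)
          (measure_ne_top μ (t ∪ tᶜ)) a ∈ S := by
        convert h2 using 2
        exact Set.union_compl_self t
      have h4 := S.sub_mem h3 ih
      rwa [h1, add_sub_cancel_left] at h4
    | iUnion t hd ht ih =>
      have hmem : ∀ n, indicatorConstLp p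
          (MeasurableSet.biUnion (Set.to_countable (Set.Iio n)) fun i _ => hle _ (ht i))
          (measure_ne_top μ (⋃ i ∈ Set.Iio n, t i)) a ∈ S := by
        intro n
        induction n with
        | zero =>
          convert S.zero_mem
          convert indicatorConstLp_empty (p := p) (μ := μ) (c := a)
          simp
        | succ n ihn =>
          have hdis : Disjoint (⋃ i ∈ Set.Iio n, t i) (t n) := by
            simp only [Set.disjoint_iUnion_left]
            exact fun i hi => hd (ne_of_lt hi)
          have := S.add_mem ihn (ih n)
          rw [← indicatorConstLp_disjoint_union _ _ _ _ hdis a] at this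
          convert this using 2
          ext x
          simp only [Set.mem_iUnion, Set.mem_Iio, exists_prop, Set.mem_union]
          constructor
          · rintro ⟨i, hi, hx⟩
            rcases Nat.lt_succ_iff_lt_or_eq.1 hi with h | rfl
            · exact Or.inl ⟨i, h, hx⟩
            · exact Or.inr hx
          · rintro (⟨i, hi, hx⟩ | hx)
            · exact ⟨i, hi.trans (Nat.lt_succ_self n), hx⟩
            · exact ⟨n, Nat.lt_succ_self n, hx⟩
      refine hS.mem_of_tendsto (b := Filter.atTop) (tendsto_indicatorConstLp_set (p := p) hp ?_)
        (Filter.Eventually.of_forall hmem)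
      have hsub : ∀ n, symmDiff (⋃ i ∈ Set.Iio n, t i) (⋃ i, t i) =
          (⋃ i, t i) \ ⋃ i ∈ Set.Iio n, t i := fun n => by
        rw [Set.symmDiff_def, Set.sdiff_eq_empty.2 (Set.iUnion₂_subset fun i _ =>
          Set.subset_iUnion t i), Set.empty_union]
      simp_rw [hsub]
      have hanti : Antitone fun n => (⋃ i, t i) \ ⋃ i ∈ Set.Iio n, t i := fun n m hnm =>
        Set.sdiff_subset_sdiff_right (Set.biUnion_subset_biUnion_left (Set.Iio_subset_Iio hnm))
      have hlim := tendsto_measure_iInter_atTop (μ := μ) (s := fun n =>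
        (⋃ i, t i) \ ⋃ i ∈ Set.Iio n, t i) (fun n => ((MeasurableSet.iUnion fun i => hle _ (ht i)).diff
          (MeasurableSet.biUnion (Set.to_countable (Set.Iio n)) fun i _ =>
            hle _ (ht i))).nullMeasurableSet) hanti ⟨0, measure_ne_top _ _⟩
      have hempty : ⋂ n, ((⋃ i, t i) \ ⋃ i ∈ Set.Iio n, t i) = ∅ := by
        ext x
        simp only [Set.mem_iInter, Set.mem_sdiff, Set.mem_iUnion, Set.mem_Iio, exists_prop,
          Set.mem_empty_iff_false, iff_false, not_forall]
        by_cases hx : ∃ i, x ∈ t i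
        · obtain ⟨i, hi⟩ := hx
          exact ⟨i + 1, fun h => h.2 ⟨i, Nat.lt_succ_self i, hi⟩⟩
        · exact ⟨0, fun h => hx h.1⟩
      rw [hempty, measure_empty] at hlim
      exact hlim
  refine Lp.induction hp (fun f => f ∈ S) ?_ ?_ hS f
  · intro a s hs hμs
    obtain ⟨t, ht, hst⟩ := hκ.generating s hs
    rw [Lp.simpleFunc.coe_indicatorConst]
    convert hcell t ht a using 1
    refine MemLp.toLp_congr _ _ ?_
    exact indicator_ae_eq_of_ae_eq_set hst
  · exact fun f g hf hg _ hfS hgS => S.add_mem hfS hgS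

end IsDyadicCoding

/-! ### Cell averages and Haar coefficients as functionals on L^p. -/

theorem rpow_norm_setIntegral_le {α E : Type*} [MeasurableSpace α] [NormedAddCommGroup E]
    [NormedSpace ℝ E] {μ : Measure α} [IsFiniteMeasure μ] {f : α → E} {r : ℝ} (hr : 1 ≤ r)
    (hf : Integrable f μ) (hfr : Integrable (fun x => ‖f x‖ ^ r) μ) (s : Set α) :
    ‖∫ x in s, f x ∂μ‖ ^ r ≤ μ.real s ^ (r - 1) * ∫ x in s, ‖f x‖ ^ r ∂μ := by
  have hr0 : r ≠ 0 := by linarith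
  by_cases hs : μ s = 0
  · rw [Measure.restrict_eq_zero.2 hs]
    simp [Real.zero_rpow hr0]
  have : NeZero (μ.restrict s) := ⟨by simpa using hs⟩
  have hs0 : 0 < μ.real s := ENNReal.toReal_pos hs (measure_ne_top _ _)
  have hJ := (convexOn_rpow hr).map_average_le (μ := μ.restrict s) (f := fun x => ‖f x‖)
    (Real.continuous_rpow_const (by linarith)).continuousOn isClosed_Ici
    (Filter.Eventually.of_forall fun x => norm_nonneg _) hf.norm.restrict hfr.restrict
  rw [setAverage_eq, setAverage_eq, smul_eq_mul, smul_eq_mul,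
    Real.mul_rpow (by positivity) (integral_nonneg fun x => norm_nonneg _)] at hJ
  have h1 : ‖∫ x in s, f x ∂μ‖ ^ r ≤ (∫ x in s, ‖f x‖ ∂μ) ^ r :=
    Real.rpow_le_rpow (norm_nonneg _) (norm_integral_le_integral_norm _) (by linarith)
  refine h1.trans ?_
  rw [Real.inv_rpow hs0.le, inv_mul_le_iff₀ (by positivity)] at hJ
  refine hJ.trans (le_of_eq ?_)
  rw [Real.rpow_sub_one hs0.ne']
  ring

namespace IsDyadicCoding

variable {α 𝕜 : Type*} [MeasurableSpace α] [RCLike 𝕜] {μ : Measure α} [IsFiniteMeasure μ]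
  {κ : ℕ → α → ℕ} (hκ : IsDyadicCoding μ κ) {p : ℝ≥0∞} [Fact (1 ≤ p)]

theorem one_le_toReal (hp : p ≠ ∞) : 1 ≤ p.toReal :=
  (ENNReal.dichotomy p).resolve_left hp

omit [IsFiniteMeasure μ] [Fact (1 ≤ p)] in
include hκ in
theorem measure_cell_eq_zero {n k : ℕ} (hk : 2 ^ n ≤ k) : κ n ⁻¹' {k} = ∅ := by
  ext x
  simpa using ((hκ.lt n x).trans_le hk).ne

include hκ in
theorem rpow_norm_cellAvg_le (hp : p ≠ ∞) (n k : ℕ) (f : Lp 𝕜 p μ) :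
    ‖((2 : ℝ) ^ n / μ.real Set.univ) • ∫ x in κ n ⁻¹' {k}, f x ∂μ‖ ^ p.toReal ≤
      2 ^ n / μ.real Set.univ * ∫ x in κ n ⁻¹' {k}, ‖f x‖ ^ p.toReal ∂μ := by
  have hp1 := one_le_toReal (p := p) hp
  have hp0 : p ≠ 0 := (zero_lt_one.trans_le Fact.out).ne'
  rcases lt_or_ge k (2 ^ n) with hk | hk
  · have h := rpow_norm_setIntegral_le hp1 ((Lp.memLp f).integrable Fact.out)
      (integrable_norm_rpow_coe hp0 hp f) (κ n ⁻¹' {k})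
    rw [hκ.measureReal n k hk] at h
    rw [norm_smul, Real.mul_rpow (norm_nonneg _) (norm_nonneg _), Real.norm_of_nonneg
      (by positivity)]
    rcases (measureReal_nonneg (μ := μ) (s := Set.univ)).eq_or_lt with h0 | h0
    · simp [← h0, Real.zero_rpow (by linarith : p.toReal ≠ 0)]
    · refine (mul_le_mul_of_nonneg_left h (by positivity)).trans (le_of_eq ?_)
      rw [← mul_assoc]
      congr 1
      have h1 : μ.real Set.univ / 2 ^ n = ((2 : ℝ) ^ n / μ.real Set.univ)⁻¹ := by
        rw [inv_div]
      rw [h1, Real.inv_rpow (by positivity), ← Real.rpow_neg (by positivity),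
        ← Real.rpow_add (by positivity)]
      simp
  · rw [hκ.measure_cell_eq_zero hk]
    simp [Real.zero_rpow (by linarith : p.toReal ≠ 0)]

/-- The mean over the cell `k` of level `n`, as a functional on `L^p`. -/
noncomputable def cellAvg (hp : p ≠ ∞) (n k : ℕ) : StrongDual 𝕜 (Lp 𝕜 p μ) :=
  LinearMap.mkContinuous
    { toFun := fun f => ((2 : ℝ) ^ n / μ.real Set.univ) • ∫ x in κ n ⁻¹' {k}, f x ∂μ
      map_add' := fun f g => by
        have hf := (Lp.memLp f).integrable (Fact.out : 1 ≤ p)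
        have hg := (Lp.memLp g).integrable (Fact.out : 1 ≤ p)
        rw [← smul_add, ← integral_add hf.restrict hg.restrict]
        congr 1
        exact integral_congr_ae (ae_restrict_of_ae (Lp.coeFn_add f g))
      map_smul' := fun a f => by
        have h : ∫ x in κ n ⁻¹' {k}, (a • f : Lp 𝕜 p μ) x ∂μ = a • ∫ x in κ n ⁻¹' {k}, f x ∂μ :=
          (integral_congr_ae (ae_restrict_of_ae (Lp.coeFn_smul a f))).trans (integral_smul a _)
        rw [h, RingHom.id_apply, smul_comm] }
    ((2 ^ n / μ.real Set.univ) ^ (p.toReal)⁻¹) fun f => by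
      have hp1 := one_le_toReal (p := p) hp
      have hp0 : p ≠ 0 := (zero_lt_one.trans_le Fact.out).ne'
      refine (Real.rpow_le_rpow_iff (norm_nonneg _) (by positivity)
        (by linarith : 0 < p.toReal)).1 ?_
      refine (hκ.rpow_norm_cellAvg_le hp n k f).trans ?_
      rw [Real.mul_rpow (by positivity) (norm_nonneg _), ← Real.rpow_mul (by positivity),
        inv_mul_cancel₀ (by linarith), Real.rpow_one, norm_rpow_eq_integral hp0 hp]
      gcongr
      · exact Filter.Eventually.of_forall fun x => by positivity
      · exact integrable_norm_rpow_coe hp0 hp f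
      · exact Measure.restrict_le_self

theorem cellAvg_apply (hp : p ≠ ∞) (n k : ℕ) (f : Lp 𝕜 p μ) :
    hκ.cellAvg hp n k f = ((2 : ℝ) ^ n / μ.real Set.univ) • ∫ x in κ n ⁻¹' {k}, f x ∂μ := rfl

theorem isTreeMartingale_cellAvg (hp : p ≠ ∞) (f : Lp 𝕜 p μ) :
    IsTreeMartingale fun n k => hκ.cellAvg hp n k f := fun n k => by
  simp only [cellAvg_apply]
  rw [hκ.setIntegral_cell ((Lp.memLp f).integrable Fact.out) n k, pow_succ]
  simp only [RCLike.real_smul_eq_coe_mul]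
  push_cast
  ring

/-- Jensen on every cell: conditional expectations contract L^p. This supplies the hypothesis of the
tree inequalities. -/
theorem levelAvg_cellAvg_le (hp : p ≠ ∞) (f : Lp 𝕜 p μ) (n : ℕ) :
    levelAvg n (fun k => ‖hκ.cellAvg hp n k f‖ ^ p.toReal) ≤
      ‖f‖ ^ p.toReal / μ.real Set.univ := by
  have hp0 : p ≠ 0 := (zero_lt_one.trans_le Fact.out).ne'
  refine (levelAvg_mono fun k _ => hκ.rpow_norm_cellAvg_le hp n k f).trans (le_of_eq ?_)
  rw [levelAvg_const_mul, norm_rpow_eq_integral hp0 hp,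
    hκ.integral_eq_sum_cell (integrable_norm_rpow_coe hp0 hp f) n, levelAvg]
  have : (2 : ℝ) ^ n ≠ 0 := by positivity
  field_simp

theorem cellAvg_step [NeZero μ] (hp : p ≠ ∞) {n M k : ℕ} (hM : M ≤ n) (hk : k < 2 ^ n)
    (c : ℕ → 𝕜) : hκ.cellAvg hp n k (hκ.step 𝕜 p M c) = c (k / 2 ^ (n - M)) := by
  rw [cellAvg_apply, setIntegral_congr_ae (g := fun x => c (κ n x / 2 ^ (n - M)))
    (hκ.measurableSet_cell n k), hκ.setIntegral_comp (fun k => c (k / 2 ^ (n - M))) hk, smul_smul]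
  · have : μ.real Set.univ ≠ 0 := measureReal_univ_pos.ne'
    have : (2 : ℝ) ^ n ≠ 0 := by positivity
    rw [show (2 : ℝ) ^ n / μ.real Set.univ * (μ.real Set.univ / 2 ^ n) = 1 by field_simp, one_smul]
  · filter_upwards [hκ.coeFn_step (p := p) M c] with x hx _
    rw [hx, hκ.div_two_pow_of_le hM]

/-- The coefficient functionals of the Haar functions. -/
noncomputable def haarCoef (hp : p ≠ ∞) (n i : ℕ) : StrongDual 𝕜 (Lp 𝕜 p μ) :=
  (2 : 𝕜)⁻¹ • (hκ.cellAvg hp (n + 1) (2 * i) - hκ.cellAvg hp (n + 1) (2 * i + 1))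

theorem haarCoef_apply (hp : p ≠ ∞) (n i : ℕ) (f : Lp 𝕜 p μ) :
    hκ.haarCoef hp n i f = treeDiff (fun n k => hκ.cellAvg hp n k f) n i := by
  simp [haarCoef, treeDiff, div_eq_inv_mul]

/-- A function of level M ≤ n is constant on each cell of level n, so its means over the two halves
agree. Hence Haar expansions of step functions are finite. -/
theorem haarCoef_step [NeZero μ] (hp : p ≠ ∞) {n M i : ℕ} (hM : M ≤ n) (hi : i < 2 ^ n)
    (c : ℕ → 𝕜) : hκ.haarCoef hp n i (hκ.step 𝕜 p M c) = 0 := by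
  rw [haarCoef_apply, treeDiff, hκ.cellAvg_step hp (by omega) (by rw [pow_succ]; omega),
    hκ.cellAvg_step hp (by omega) (by rw [pow_succ]; omega)]
  have h : n + 1 - M = (n - M) + 1 := by omega
  rw [h, pow_succ', ← Nat.div_div_eq_div_mul, ← Nat.div_div_eq_div_mul, even_div_two, odd_div_two,
    sub_self, zero_div]

variable (p 𝕜) in
/-- The constant function one. -/
noncomputable def one : Lp 𝕜 p μ := hκ.step 𝕜 p 0 fun _ => 1

theorem sum_haarCoef_smul_haar_step [NeZero μ] (hp : p ≠ ∞) (M : ℕ) (c : ℕ → 𝕜) :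
    ∑ n ∈ Finset.range M, ∑ i ∈ Finset.range (2 ^ n),
      hκ.haarCoef hp n i (hκ.step 𝕜 p M c) • hκ.haar 𝕜 p n i =
    hκ.step 𝕜 p M c - hκ.cellAvg hp 0 0 (hκ.step 𝕜 p M c) • hκ.one 𝕜 p := by
  have hone : hκ.one 𝕜 p = hκ.step 𝕜 p M fun _ => 1 := hκ.step_congr fun x => rfl
  set f := hκ.step 𝕜 p M c with hf
  rw [hκ.sum_smul_haar (fun n i => hκ.haarCoef hp n i f), hone, ← map_smul, hf, ← map_sub, ← hf]
  refine hκ.step_congr_of_lt fun k hk => ?_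
  have h1 := (hκ.isTreeMartingale_cellAvg hp f).apply_eq_add_haarSum M k hk
  have h2 : (fun n i => hκ.haarCoef hp n i f) = treeDiff fun n k => hκ.cellAvg hp n k f := by
    ext n i
    exact hκ.haarCoef_apply hp n i f
  rw [h2]
  have h3 : hκ.cellAvg hp M k f = c k := by
    rw [hf, hκ.cellAvg_step hp le_rfl hk]
    simp
  rw [h3] at h1
  simp [h1]

/-- The tree inequalities assume a mean at most 1, a normalization matched to the floor 1 in
`predMax`. Dividing by s, the L^p mean of f, restores homogeneity. -/
theorem exists_scale [NeZero μ] (hp : p ≠ ∞) {f : Lp 𝕜 p μ} (hf : f ≠ 0) :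
    ∃ s : ℝ, 0 < s ∧ s ^ p.toReal = ‖f‖ ^ p.toReal / μ.real Set.univ ∧
      ∀ N, levelAvg N (fun k => ‖hκ.cellAvg hp N k ((s : 𝕜)⁻¹ • f)‖ ^ p.toReal) ≤ 1 := by
  have hp1 := one_le_toReal (p := p) hp
  have hm : 0 < μ.real Set.univ := measureReal_univ_pos
  have hf0 : 0 < ‖f‖ := norm_pos_iff.2 hf
  have hs : ((‖f‖ ^ p.toReal / μ.real Set.univ) ^ p.toReal⁻¹) ^ p.toReal =
      ‖f‖ ^ p.toReal / μ.real Set.univ := by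
    rw [← Real.rpow_mul (by positivity), inv_mul_cancel₀ (by linarith), Real.rpow_one]
  refine ⟨(‖f‖ ^ p.toReal / μ.real Set.univ) ^ p.toReal⁻¹, by positivity, hs, fun N => ?_⟩
  refine (hκ.levelAvg_cellAvg_le hp _ N).trans (le_of_eq ?_)
  rw [norm_smul, norm_inv, RCLike.norm_ofReal, abs_of_pos (by positivity),
    Real.mul_rpow (by positivity) (by positivity), Real.inv_rpow (by positivity), hs]
  field_simp

/-- Multipliers of the Haar coefficients are bounded in `L^p`. -/
theorem norm_haar_transform_le [NeZero μ] (hp1 : 1 < p) (hp2 : p ≤ 2) :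
    ∃ C : ℝ, 0 < C ∧ ∀ (hp : p ≠ ∞) (f : Lp 𝕜 p μ) (c : ℕ → ℕ → 𝕜),
      (∀ n i, ‖c n i‖ ≤ ‖hκ.haarCoef hp n i f‖) → ∀ N,
      ‖∑ n ∈ Finset.range N, ∑ i ∈ Finset.range (2 ^ n), c n i • hκ.haar 𝕜 p n i‖ ≤ C * ‖f‖ := by
  have hp' : p ≠ ∞ := (hp2.trans_lt (by simp)).ne
  have hp0 : p ≠ 0 := (zero_lt_one.trans hp1).ne'
  have hr1 : 1 < p.toReal := by
    simpa using (ENNReal.toReal_lt_toReal ENNReal.one_ne_top hp').2 hp1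
  have hr2 : p.toReal ≤ 2 := by
    simpa using (ENNReal.toReal_le_toReal hp' (by simp)).2 hp2
  obtain ⟨C, hC, h⟩ := levelAvg_haarSum_transform_le (𝕜 := 𝕜) hr1 hr2
  refine ⟨C ^ p.toReal⁻¹, by positivity, fun hp f c hc N => ?_⟩
  rcases eq_or_ne f 0 with rfl | hf
  · have hc0 : ∀ n i, c n i = 0 := fun n i => by simpa using hc n i
    simp [hc0]
  obtain ⟨s, hs0, hs, hfs⟩ := hκ.exists_scale hp hf
  have hm : 0 < μ.real Set.univ := measureReal_univ_pos
  have h1 := h (fun n k => hκ.cellAvg hp n k ((s : 𝕜)⁻¹ • f)) (fun n i => (s : 𝕜)⁻¹ • c n i)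
    (hκ.isTreeMartingale_cellAvg hp _) (fun n i => by
      rw [← haarCoef_apply, map_smul, norm_smul, norm_smul]
      exact mul_le_mul_of_nonneg_left (hc n i) (norm_nonneg _)) N (hfs N)
  have h2 := hκ.norm_sum_smul_haar_rpow hp0 hp (fun n i => (s : 𝕜)⁻¹ • c n i) N
  simp only [smul_assoc, ← Finset.smul_sum] at h2
  rw [norm_smul, norm_inv, RCLike.norm_ofReal, abs_of_pos hs0,
    Real.mul_rpow (by positivity) (norm_nonneg _), Real.inv_rpow hs0.le, hs,
    inv_mul_eq_iff_eq_mul₀ (by have := norm_pos_iff.2 hf; positivity)] at h2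
  refine (Real.rpow_le_rpow_iff (norm_nonneg _) (by positivity)
    (by linarith : 0 < p.toReal)).1 ?_
  rw [h2, Real.mul_rpow (by positivity) (norm_nonneg _), ← Real.rpow_mul hC.le,
    inv_mul_cancel₀ (by linarith), Real.rpow_one]
  calc _ = ‖f‖ ^ p.toReal * levelAvg N fun k =>
        ‖haarSum (fun n i => (s : 𝕜)⁻¹ • c n i) N k‖ ^ p.toReal := by
        field_simp
    _ ≤ ‖f‖ ^ p.toReal * C := mul_le_mul_of_nonneg_left h1 (by positivity)
    _ = _ := mul_comm _ _

/-- The coefficients with respect to the normalized Haar system are square summable. -/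
theorem sum_sq_haarCoef_le [NeZero μ] (hp1 : 1 < p) (hp2 : p ≤ 2) :
    ∃ C : ℝ, 0 < C ∧ ∀ (hp : p ≠ ∞) (f : Lp 𝕜 p μ) (N : ℕ),
      ∑ n ∈ Finset.range N, ∑ i ∈ Finset.range (2 ^ n),
        ((2 : ℝ) ^ n) ^ (-(2 / p.toReal)) * ‖hκ.haarCoef hp n i f‖ ^ 2 ≤ C * ‖f‖ ^ 2 := by
  have hp' : p ≠ ∞ := (hp2.trans_lt (by simp)).ne
  have hr1 : 1 < p.toReal := by
    simpa using (ENNReal.toReal_lt_toReal ENNReal.one_ne_top hp').2 hp1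
  have hr2 : p.toReal ≤ 2 := by
    simpa using (ENNReal.toReal_le_toReal hp' (by simp)).2 hp2
  obtain ⟨C, hC, h⟩ := sum_sq_treeDiff_le (𝕜 := 𝕜) hr1 hr2
  have hm : 0 < μ.real Set.univ := measureReal_univ_pos
  refine ⟨C * (μ.real Set.univ ^ p.toReal⁻¹)⁻¹ ^ 2, by positivity, fun hp f N => ?_⟩
  rcases eq_or_ne f 0 with rfl | hf
  · simp
  obtain ⟨s, hs0, hs, hfs⟩ := hκ.exists_scale hp hf
  have h1 := h (fun n k => hκ.cellAvg hp n k ((s : 𝕜)⁻¹ • f)) (hκ.isTreeMartingale_cellAvg hp _) N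
    (hfs N)
  have hterm : ∀ n i, ‖treeDiff (fun n k => hκ.cellAvg hp n k ((s : 𝕜)⁻¹ • f)) n i‖ ^ 2 =
      s⁻¹ ^ 2 * ‖hκ.haarCoef hp n i f‖ ^ 2 := fun n i => by
    rw [← haarCoef_apply, map_smul, norm_smul, norm_inv, RCLike.norm_ofReal, abs_of_pos hs0,
      mul_pow]
  simp only [hterm, mul_left_comm _ (s⁻¹ ^ 2), ← Finset.mul_sum] at h1
  rw [inv_pow, inv_mul_le_iff₀ (by positivity)] at h1
  have hs' : s = ‖f‖ * (μ.real Set.univ ^ p.toReal⁻¹)⁻¹ := by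
    refine (Real.rpow_left_inj hs0.le (by positivity) (by linarith : p.toReal ≠ 0)).1 ?_
    rw [hs, Real.mul_rpow (norm_nonneg _) (by positivity), Real.inv_rpow (by positivity),
      ← Real.rpow_mul hm.le, inv_mul_cancel₀ (by linarith), Real.rpow_one, div_eq_mul_inv]
  simp only [← Finset.mul_sum]
  refine h1.trans (le_of_eq ?_)
  rw [hs']
  ring

end IsDyadicCoding

/-! ### Summability criterion, multiplicities and indices of repeated Haar functions. -/

/-- A series whose finite sums are controlled by those of a convergent series with nonnegative
terms is unconditionally convergent. -/
theorem summable_of_norm_sum_rpow_le {ι X : Type*} [NormedAddCommGroup X] [CompleteSpace X]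
    {v : ι → X} {a : ι → ℝ} {C q r : ℝ} (ha : Summable a)
    (hC : 0 ≤ C) (hq : 0 < q) (hr : 0 < r) (ha0 : ∀ i, 0 ≤ a i)
    (h : ∀ t : Finset ι, ‖∑ i ∈ t, v i‖ ^ r ≤ C * (∑ i ∈ t, a i) ^ q) : Summable v := by
  rw [summable_iff_vanishing_norm] at ha ⊢
  intro ε hε
  obtain ⟨δ, hδ, hδC⟩ : ∃ δ : ℝ, 0 < δ ∧ C * δ ^ q < ε ^ r := by
    refine ⟨(ε ^ r / (C + 1)) ^ q⁻¹, by positivity, ?_⟩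
    rw [← Real.rpow_mul (by positivity), inv_mul_cancel₀ hq.ne', Real.rpow_one, mul_div_assoc',
      div_lt_iff₀ (by positivity)]
    have : 0 < ε ^ r := by positivity
    nlinarith
  obtain ⟨s, hs⟩ := ha δ hδ
  refine ⟨s, fun t ht => ?_⟩
  have h1 : ∑ i ∈ t, a i < δ := (le_abs_self _).trans_lt (hs t ht)
  have h0 : 0 ≤ ∑ i ∈ t, a i := Finset.sum_nonneg fun i _ => ha0 i
  refine (Real.rpow_lt_rpow_iff (norm_nonneg _) hε.le hr).1 ((h t).trans_lt (lt_of_le_of_lt ?_ hδC))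
  exact mul_le_mul_of_nonneg_left (Real.rpow_le_rpow h0 h1.le hq.le) hC

theorem levelAvg_rpow_le {r : ℝ} (hr : 0 < r) (hr2 : r ≤ 2) (F : ℕ → ℝ) (hF : ∀ k, 0 ≤ F k)
    (n : ℕ) : levelAvg n (fun k => F k ^ r) ≤ levelAvg n (fun k => F k ^ 2) ^ (r / 2) := by
  have h := Real.rpow_arith_mean_le_arith_mean_rpow (Finset.range (2 ^ n))
    (fun _ => ((2 : ℝ) ^ n)⁻¹) (fun k => F k ^ r) (fun _ _ => by positivity) (by simp)
    (fun k _ => Real.rpow_nonneg (hF k) r) (p := 2 / r) (by rwa [le_div_iff₀ hr, one_mul])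
  have h2 : ∀ k, (F k ^ r) ^ (2 / r) = F k ^ 2 := fun k => by
    rw [← Real.rpow_mul (hF k), mul_div_cancel₀ _ hr.ne', Real.rpow_two]
  simp only [h2, inv_mul_eq_div, ← Finset.sum_div] at h
  change levelAvg n _ ^ _ ≤ levelAvg n _ at h
  have h0 : 0 ≤ levelAvg n (fun k => F k ^ r) := levelAvg_nonneg fun k => Real.rpow_nonneg (hF k) r
  have h3 := Real.rpow_le_rpow (Real.rpow_nonneg h0 _) h (by positivity : 0 ≤ r / 2)
  rwa [← Real.rpow_mul h0, show 2 / r * (r / 2) = 1 by field_simp, Real.rpow_one] at h3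

/-- Suitable multiplicities of the Haar functions. -/
theorem exists_multiplicity {r : ℝ} (hr : 1 < r) (hr2 : r ≤ 2) :
    ∃ K : ℕ → ℕ, ∀ n, 0 < K n ∧ (K n : ℝ) ^ (r - 1) ≤ 2 * 2 ^ n ∧ ((2 : ℝ) ^ n) ^ (2 / r) ≤ K n := by
  -- The upper bound dictates the size 2^(n/(r-1)), with the constant 2 absorbing the rounding. The
  -- lower bound then holds because 2/r ≤ 1/(r-1) for r ≤ 2.
  refine ⟨fun n => ⌈((2 : ℝ) ^ n) ^ (r - 1)⁻¹⌉₊, fun n => ?_⟩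
  have hr1 : 0 < r - 1 := by linarith
  have h2 : (1 : ℝ) ≤ 2 ^ n := one_le_pow₀ one_le_two
  have hx : 1 ≤ ((2 : ℝ) ^ n) ^ (r - 1)⁻¹ := Real.one_le_rpow h2 (by positivity)
  refine ⟨Nat.ceil_pos.2 (by linarith), ?_, le_trans ?_ (Nat.le_ceil _)⟩
  · have h1 : (⌈((2 : ℝ) ^ n) ^ (r - 1)⁻¹⌉₊ : ℝ) ≤ 2 * ((2 : ℝ) ^ n) ^ (r - 1)⁻¹ := by
      linarith [Nat.ceil_lt_add_one (by linarith : 0 ≤ ((2 : ℝ) ^ n) ^ (r - 1)⁻¹)]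
    refine (Real.rpow_le_rpow (by positivity) h1 hr1.le).trans ?_
    rw [Real.mul_rpow (by norm_num) (by positivity), ← Real.rpow_mul (by positivity),
      inv_mul_cancel₀ hr1.ne', Real.rpow_one]
    gcongr
    calc (2 : ℝ) ^ (r - 1) ≤ 2 ^ (1 : ℝ) :=
          Real.rpow_le_rpow_of_exponent_le one_le_two (by linarith)
      _ = 2 := Real.rpow_one 2
  · refine Real.rpow_le_rpow_of_exponent_le h2 ?_
    rw [← one_div, div_le_div_iff₀ (by linarith) hr1]
    linarith

/-- Indices of the Haar functions, where those of level `n` are repeated `K n` times. -/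
abbrev HaarIndex (K : ℕ → ℕ) : Type := Σ n : ℕ, Fin (2 ^ n) × Fin (K n)

namespace HaarIndex

variable {K : ℕ → ℕ}

/-- A code for an index, at least as large as its level. -/
def code (e : HaarIndex K) : ℕ := Nat.pair e.1 (Nat.pair e.2.1 e.2.2)

theorem code_injective : Function.Injective (code (K := K)) := by
  rintro ⟨n, i, j⟩ ⟨n', i', j'⟩ h
  simp only [code, Nat.pair_eq_pair] at h
  obtain ⟨rfl, hi, hj⟩ := h
  rw [Fin.ext hi, Fin.ext hj]

/-- Makes the cell of an index a union of cells of level `e.code`, so that the Rademacher function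
of that level can be cut off on it. -/
theorem fst_le_code (e : HaarIndex K) : e.1 ≤ e.code := Nat.left_le_pair _ _

theorem sum_level {M : Type*} [AddCommMonoid M] (N : ℕ) (G : (n : ℕ) → ℕ → M) :
    ∑ e ∈ (Finset.range N).sigma fun n => (Finset.univ : Finset (Fin (2 ^ n) × Fin (K n))),
      G e.1 e.2.1 = ∑ n ∈ Finset.range N, ∑ i ∈ Finset.range (2 ^ n), K n • G n i := by
  rw [Finset.sum_sigma]
  refine Finset.sum_congr rfl fun n _ => ?_
  rw [Fintype.sum_prod_type, Finset.sum_range]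
  simp

theorem exists_subset_level (F : Finset (HaarIndex K)) :
    ∃ N, F ⊆ (Finset.range N).sigma fun n => (Finset.univ : Finset (Fin (2 ^ n) × Fin (K n))) := by
  refine ⟨F.sup (fun e => e.1) + 1, fun e he => ?_⟩
  simpa [Nat.lt_succ_iff] using Finset.le_sup (f := fun e : HaarIndex K => e.1) he

theorem card_filter_le (F : Finset (HaarIndex K)) (n i : ℕ) :
    (F.filter fun e => e.1 = n ∧ (e.2.1 : ℕ) = i).card ≤ K n := by
  classical
  have h : Set.InjOn (fun e : HaarIndex K => (e.2.2 : ℕ))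
      (F.filter fun e => e.1 = n ∧ (e.2.1 : ℕ) = i) := by
    rintro ⟨n₁, i₁, j₁⟩ h₁ ⟨n₂, i₂, j₂⟩ h₂ h
    simp only [Finset.coe_filter, Set.mem_ofPred_eq] at h₁ h₂ h
    obtain ⟨-, rfl, hi₁⟩ := h₁
    obtain ⟨-, rfl, hi₂⟩ := h₂
    rw [Fin.ext (hi₁.trans hi₂.symm), Fin.ext h]
  rw [← Finset.card_image_of_injOn h]
  refine (Finset.card_le_card (t := Finset.range (K n)) fun j hj => ?_).trans (by simp)
  simp only [Finset.mem_image, Finset.mem_filter] at hj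
  obtain ⟨⟨n₁, i₁, j₁⟩, ⟨-, rfl, -⟩, rfl⟩ := hj
  simp

end HaarIndex

/-! ### Upper estimates for sums of noises and of repeated Haar functions. -/

namespace IsDyadicCoding

variable {α 𝕜 : Type*} [MeasurableSpace α] [RCLike 𝕜] {μ : Measure α} [IsFiniteMeasure μ]
  {κ : ℕ → α → ℕ} (hκ : IsDyadicCoding μ κ) {p : ℝ≥0∞} {K : ℕ → ℕ}

variable (p 𝕜) in
/-- The Rademacher function of level `e.code`, cancelled on the support of the Haar function with
index `e`. -/
noncomputable def noise (e : HaarIndex K) : Lp 𝕜 p μ :=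
  hκ.step 𝕜 p (e.code + 1) fun k => if k / 2 ^ (e.code + 1 - e.1) = e.2.1 then 0 else (-1) ^ k

theorem noise_eq_sum_haar (e : HaarIndex K) :
    hκ.noise 𝕜 p e = ∑ k ∈ Finset.range (2 ^ e.code),
      (if k / 2 ^ (e.code - e.1) = e.2.1 then (0 : 𝕜) else 1) • hκ.haar 𝕜 p e.code k := by
  rw [hκ.sum_smul_haar_level fun k => if k / 2 ^ (e.code - e.1) = e.2.1 then (0 : 𝕜) else 1, noise]
  congr 1
  ext k
  have h := e.fst_le_code
  rw [Nat.div_div_eq_div_mul, ← pow_succ', show e.code + 1 - e.1 = e.code - e.1 + 1 by omega]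
  split_ifs <;> simp

theorem sum_smul_eq_sum_haar (F : Finset (HaarIndex K)) (b : HaarIndex K → 𝕜) (N : ℕ)
    (w : HaarIndex K → ℕ → ℕ → 𝕜) (v : HaarIndex K → Lp 𝕜 p μ)
    (hv : ∀ e ∈ F, v e = ∑ l ∈ Finset.range N, ∑ k ∈ Finset.range (2 ^ l),
      w e l k • hκ.haar 𝕜 p l k) :
    ∑ e ∈ F, b e • v e = ∑ l ∈ Finset.range N, ∑ k ∈ Finset.range (2 ^ l),
      (∑ e ∈ F, b e * w e l k) • hκ.haar 𝕜 p l k := by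
  simp only [Finset.sum_smul]
  rw [Finset.sum_congr rfl fun e he => by rw [hv e he]]
  simp only [Finset.smul_sum, smul_smul]
  rw [Finset.sum_comm]
  exact Finset.sum_congr rfl fun l _ => Finset.sum_comm

/-- Codes are injective, so distinct noises live on distinct Haar levels and are orthogonal in L²,
with coefficients bounded by one. For p ≤ 2 the normalized L^p mean is at most the L² mean. -/
theorem norm_sum_noise_rpow_le (hp1 : 1 ≤ p) (hp2 : p ≤ 2) (F : Finset (HaarIndex K))
    (b : HaarIndex K → 𝕜) :
    ‖∑ e ∈ F, b e • hκ.noise 𝕜 p e‖ ^ p.toReal ≤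
      μ.real Set.univ * (∑ e ∈ F, ‖b e‖ ^ 2) ^ (p.toReal / 2) := by
  classical
  have hp' : p ≠ ∞ := (hp2.trans_lt (by simp)).ne
  have hp0 : p ≠ 0 := (zero_lt_one.trans_le hp1).ne'
  have hr2 : p.toReal ≤ 2 := by
    simpa using (ENNReal.toReal_le_toReal hp' (by simp)).2 hp2
  set N := F.sup HaarIndex.code + 1 with hN
  have hFN : ∀ e ∈ F, e.code < N := fun e he => Nat.lt_succ_of_le (Finset.le_sup he)
  set w : HaarIndex K → ℕ → ℕ → 𝕜 := fun e l k =>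
    if e.code = l then (if k / 2 ^ (l - e.1) = e.2.1 then 0 else 1) else 0 with hw
  rw [hκ.sum_smul_eq_sum_haar F b N w _ fun e he => ?_,
    hκ.norm_sum_smul_haar_rpow hp0 hp' (fun l k => ∑ e ∈ F, b e * w e l k)]
  · refine mul_le_mul_of_nonneg_left ((levelAvg_rpow_le (ENNReal.toReal_pos hp0 hp') hr2 _
      (fun k => norm_nonneg _) N).trans ?_) measureReal_nonneg
    refine Real.rpow_le_rpow (levelAvg_nonneg fun k => by positivity) ?_ (by positivity)
    rw [levelAvg_haarSum_sq]
    have hsum : ∑ e ∈ F, ‖b e‖ ^ 2 =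
        ∑ l ∈ Finset.range N, ∑ e ∈ F, if e.code = l then ‖b e‖ ^ 2 else 0 := by
      rw [Finset.sum_comm]
      refine Finset.sum_congr rfl fun e he => ?_
      rw [Finset.sum_ite_eq, if_pos (Finset.mem_range.2 (hFN e he))]
    rw [hsum]
    refine Finset.sum_le_sum fun l _ => ?_
    refine (levelAvg_mono fun k _ => ?_).trans (levelAvg_const l _).le
    by_cases h : ∃ e ∈ F, e.code = l
    · obtain ⟨e, he, rfl⟩ := h
      have hne : ∀ e' ∈ F, e' ≠ e → e'.code ≠ e.code := fun e' _ h h' =>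
        h (HaarIndex.code_injective h')
      rw [Finset.sum_eq_single_of_mem e he fun e' he' h => by simp [hw, hne e' he' h],
        Finset.sum_eq_single_of_mem e he fun e' he' h => by simp [hne e' he' h]]
      simp only [hw, if_true]
      split_ifs
      · simp
      · simp
    · push Not at h
      rw [Finset.sum_eq_zero fun e he => by simp [hw, h e he],
        Finset.sum_eq_zero fun e he => by simp [h e he]]
      simp
  · rw [Finset.sum_eq_single_of_mem e.code (Finset.mem_range.2 (hFN e he))]
    · simp only [hw, if_true]
      exact hκ.noise_eq_sum_haar e
    · intro l _ hl
      simp [hw, hl.symm]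

theorem sum_smul_haar_index (F : Finset (HaarIndex K)) (b : HaarIndex K → 𝕜) {N : ℕ}
    (hN : ∀ e ∈ F, e.1 < N) :
    ∑ e ∈ F, b e • hκ.haar 𝕜 p e.1 e.2.1 =
      ∑ l ∈ Finset.range N, ∑ k ∈ Finset.range (2 ^ l),
        (∑ e ∈ F with e.1 = l ∧ (e.2.1 : ℕ) = k, b e) • hκ.haar 𝕜 p l k := by
  classical
  rw [hκ.sum_smul_eq_sum_haar F b N
    (fun e l k => if e.1 = l ∧ (e.2.1 : ℕ) = k then 1 else 0) _ fun e he => ?_]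
  · simp [Finset.sum_filter]
  · rw [Finset.sum_eq_single_of_mem e.1 (Finset.mem_range.2 (hN e he)),
      Finset.sum_eq_single_of_mem (e.2.1 : ℕ) (Finset.mem_range.2 e.2.1.2)]
    · simp
    · intro k _ hk
      simp [hk.symm]
    · intro l _ hl
      simp [hl.symm]

/-- Type p of the Haar system, after collecting the copies of each function. Hölder over at most `K
l` copies costs `K l`^(p-1), which the measure 2^(-l) of the cell compensates up to the factor 2. -/
theorem norm_sum_haar_rpow_le (hp1 : 1 ≤ p) (hp2 : p ≤ 2)
    (hK : ∀ n, (K n : ℝ) ^ (p.toReal - 1) ≤ 2 * 2 ^ n) (F : Finset (HaarIndex K))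
    (b : HaarIndex K → 𝕜) :
    ‖∑ e ∈ F, b e • hκ.haar 𝕜 p e.1 e.2.1‖ ^ p.toReal ≤
      μ.real Set.univ * 2 * ∑ e ∈ F, ‖b e‖ ^ p.toReal := by
  classical
  have hp' : p ≠ ∞ := (hp2.trans_lt (by simp)).ne
  have hp0 : p ≠ 0 := (zero_lt_one.trans_le hp1).ne'
  have hr2 : p.toReal ≤ 2 := by
    simpa using (ENNReal.toReal_le_toReal hp' (by simp)).2 hp2
  have hr1 : 1 ≤ p.toReal := by
    simpa using (ENNReal.toReal_le_toReal ENNReal.one_ne_top hp').2 hp1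
  obtain ⟨N, hN⟩ := HaarIndex.exists_subset_level F
  have hFN : ∀ e ∈ F, e.1 < N := fun e he => by simpa using hN he
  rw [hκ.sum_smul_haar_index F b hFN, hκ.norm_sum_smul_haar_rpow hp0 hp'
    (fun l k => ∑ e ∈ F with e.1 = l ∧ (e.2.1 : ℕ) = k, b e), mul_assoc]
  refine mul_le_mul_of_nonneg_left ((levelAvg_haarSum_rpow_le (by linarith) hr2 _ N).trans ?_)
    measureReal_nonneg
  have hsum : ∑ e ∈ F, ‖b e‖ ^ p.toReal = ∑ l ∈ Finset.range N, ∑ k ∈ Finset.range (2 ^ l),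
      ∑ e ∈ F with e.1 = l ∧ (e.2.1 : ℕ) = k, ‖b e‖ ^ p.toReal := by
    simp only [Finset.sum_filter]
    rw [Finset.sum_congr rfl fun l _ => Finset.sum_comm, Finset.sum_comm]
    refine Finset.sum_congr rfl fun e he => ?_
    rw [Finset.sum_eq_single_of_mem e.1 (Finset.mem_range.2 (hFN e he)),
      Finset.sum_eq_single_of_mem (e.2.1 : ℕ) (Finset.mem_range.2 e.2.1.2)]
    · simp
    · intro k _ hk
      simp [hk.symm]
    · intro l _ hl
      simp [hl.symm]
  rw [hsum, Finset.mul_sum]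
  refine Finset.sum_le_sum fun l _ => ?_
  rw [levelAvg, Finset.mul_sum, Finset.sum_div]
  refine Finset.sum_le_sum fun k _ => ?_
  rw [div_le_iff₀ (by positivity)]
  have h1 : ‖∑ e ∈ F with e.1 = l ∧ (e.2.1 : ℕ) = k, b e‖ ^ p.toReal ≤
      (∑ e ∈ F with e.1 = l ∧ (e.2.1 : ℕ) = k, |‖b e‖|) ^ p.toReal := by
    refine Real.rpow_le_rpow (norm_nonneg _) ?_ (by linarith)
    simpa using norm_sum_le _ _
  have h2 := Real.rpow_sum_le_const_mul_sum_rpow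
    (F.filter fun e => e.1 = l ∧ (e.2.1 : ℕ) = k) (fun e => ‖b e‖) hr1
  simp only [abs_norm] at h1 h2
  have h3 : ((F.filter fun e => e.1 = l ∧ (e.2.1 : ℕ) = k).card : ℝ) ^ (p.toReal - 1) ≤
      2 * 2 ^ l := by
    refine (Real.rpow_le_rpow (by positivity) ?_ (by linarith)).trans (hK l)
    exact_mod_cast HaarIndex.card_filter_le F l k
  refine (h1.trans h2).trans ((mul_le_mul_of_nonneg_right h3
    (Finset.sum_nonneg fun e _ => by positivity)).trans (le_of_eq ?_))
  ring

end IsDyadicCoding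

/-! ### Unconditional convergence on closed subspaces, and the two families of functionals. -/

/-- The set of points where a series of bounded operators with uniformly bounded finite sums
converges unconditionally to a bounded operator is a closed subspace. -/
theorem exists_isClosed_hasSum_submodule {ι 𝕜 X Y : Type*} [RCLike 𝕜] [NormedAddCommGroup X]
    [NormedSpace 𝕜 X] [NormedAddCommGroup Y] [NormedSpace 𝕜 Y] (T : ι → X →L[𝕜] Y) (L : X →L[𝕜] Y)
    {C : ℝ} (hC : ∀ (F : Finset ι) (x : X), ‖∑ i ∈ F, T i x‖ ≤ C * ‖x‖) :
    ∃ S : Submodule 𝕜 X, IsClosed (S : Set X) ∧ ∀ x, x ∈ S ↔ HasSum (fun i => T i x) (L x) := by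
  refine ⟨{ carrier := {x | HasSum (fun i => T i x) (L x)}
            add_mem' := fun {x y} hx hy => ?_
            zero_mem' := ?_
            smul_mem' := fun a x hx => ?_ }, ?_, fun x => Iff.rfl⟩
  · simpa using HasSum.add hx hy
  · simp [hasSum_zero]
  · simpa using HasSum.const_smul a hx
  · refine isClosed_of_closure_subset fun x hx => ?_
    refine Metric.tendsto_nhds.2 fun ε hε => ?_
    have hC0 : 0 < |C| + ‖L‖ + 1 := by positivity
    obtain ⟨y, hy, hxy⟩ := Metric.mem_closure_iff.1 hx (ε / 2 / (|C| + ‖L‖ + 1)) (by positivity)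
    have hy' : HasSum (fun i => T i y) (L y) := hy
    filter_upwards [Metric.tendsto_nhds.1 hy' (ε / 2) (by positivity)] with F hF
    rw [dist_eq_norm] at hF hxy ⊢
    have h1 : ∑ i ∈ F, T i x - L x =
        ∑ i ∈ F, T i (x - y) + (∑ i ∈ F, T i y - L y) - L (x - y) := by
      simp only [map_sub, Finset.sum_sub_distrib]
      abel
    have h2 : ‖∑ i ∈ F, T i (x - y)‖ ≤ |C| * ‖x - y‖ :=
      (hC F _).trans (mul_le_mul_of_nonneg_right (le_abs_self C) (norm_nonneg _))
    have h3 := L.le_opNorm (x - y)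
    have h4 : (|C| + ‖L‖ + 1) * ‖x - y‖ < ε / 2 := by
      rwa [lt_div_iff₀' hC0] at hxy
    rw [h1]
    have h5 := norm_sub_le (∑ i ∈ F, T i (x - y) + (∑ i ∈ F, T i y - L y)) (L (x - y))
    have h6 := norm_add_le (∑ i ∈ F, T i (x - y)) (∑ i ∈ F, T i y - L y)
    nlinarith [norm_nonneg (x - y)]

namespace IsDyadicCoding

variable {α 𝕜 : Type*} [MeasurableSpace α] [RCLike 𝕜] {μ : Measure α} [IsFiniteMeasure μ]
  {κ : ℕ → α → ℕ} (hκ : IsDyadicCoding μ κ) {p : ℝ≥0∞} [Fact (1 ≤ p)] {K : ℕ → ℕ}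

theorem norm_cellAvg_le (hp : p ≠ ∞) (n k : ℕ) :
    ‖hκ.cellAvg (𝕜 := 𝕜) hp n k‖ ≤ (2 ^ n / μ.real Set.univ) ^ (p.toReal)⁻¹ :=
  LinearMap.mkContinuous_norm_le _ (by positivity) _

theorem norm_haarCoef_le (hp : p ≠ ∞) (n i : ℕ) :
    ‖hκ.haarCoef (𝕜 := 𝕜) hp n i‖ ≤ (2 ^ (n + 1) / μ.real Set.univ) ^ (p.toReal)⁻¹ := by
  rw [haarCoef, norm_smul, norm_inv, RCLike.norm_ofNat]
  have h1 := hκ.norm_cellAvg_le (𝕜 := 𝕜) hp (n + 1) (2 * i)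
  have h2 := hκ.norm_cellAvg_le (𝕜 := 𝕜) hp (n + 1) (2 * i + 1)
  have h3 := norm_sub_le (hκ.cellAvg (𝕜 := 𝕜) hp (n + 1) (2 * i))
    (hκ.cellAvg hp (n + 1) (2 * i + 1))
  linarith

/-- The coefficient functional of a repeated Haar function, divided by its total multiplicity. -/
noncomputable def smallCoef (hp : p ≠ ∞) (e : HaarIndex K) : StrongDual 𝕜 (Lp 𝕜 p μ) :=
  (4 * (K e.1 : 𝕜))⁻¹ • hκ.haarCoef hp e.1 e.2.1

/-- Normalized functionals with disjoint supports. -/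
noncomputable def unitCoef (hp : p ≠ ∞) (e : HaarIndex K) : StrongDual 𝕜 (Lp 𝕜 p μ) :=
  (((μ.real Set.univ / 2 ^ (e.code + 1)) ^ (p.toReal)⁻¹ : ℝ) : 𝕜) • hκ.cellAvg hp (e.code + 1) 1

theorem norm_smallCoef_le (hp : p ≠ ∞) (hK0 : ∀ n, 0 < K n)
    (hK : ∀ n, ((2 : ℝ) ^ n) ^ (2 / p.toReal) ≤ K n) (e : HaarIndex K) :
    ‖hκ.smallCoef (𝕜 := 𝕜) hp e‖ ≤ (2 / μ.real Set.univ) ^ (p.toReal)⁻¹ := by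
  have hr := one_le_toReal (p := p) hp
  have h1 := hκ.norm_haarCoef_le (𝕜 := 𝕜) hp e.1 e.2.1
  have hK1 : (0 : ℝ) < K e.1 := by exact_mod_cast hK0 e.1
  have h2 : ((2 : ℝ) ^ e.1) ^ (p.toReal)⁻¹ ≤ K e.1 := by
    refine le_trans (Real.rpow_le_rpow_of_exponent_le (one_le_pow₀ one_le_two) ?_) (hK e.1)
    rw [← one_div]
    gcongr
    norm_num
  rw [smallCoef, norm_smul, norm_inv, norm_mul, RCLike.norm_ofNat, RCLike.norm_natCast,
    inv_mul_le_iff₀ (by positivity)]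
  refine h1.trans ?_
  rw [pow_succ, mul_div_assoc, Real.mul_rpow (by positivity) (by positivity)]
  refine mul_le_mul_of_nonneg_right ?_ (by positivity)
  linarith

theorem norm_unitCoef [NeZero μ] (hp : p ≠ ∞) (e : HaarIndex K) :
    ‖hκ.unitCoef (𝕜 := 𝕜) hp e‖ = 1 := by
  have hr := one_le_toReal (p := p) hp
  have hp0 : p ≠ 0 := (zero_lt_one.trans_le Fact.out).ne'
  have hm : 0 < μ.real Set.univ := measureReal_univ_pos
  set x : ℝ := (μ.real Set.univ / 2 ^ (e.code + 1)) ^ (p.toReal)⁻¹ with hx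
  have hx0 : 0 < x := by positivity
  have h1k : 1 < 2 ^ (e.code + 1) := Nat.one_lt_two_pow (by omega)
  apply le_antisymm
  · rw [unitCoef, norm_smul, RCLike.norm_ofReal, ← hx, abs_of_pos hx0]
    refine (mul_le_mul_of_nonneg_left (hκ.norm_cellAvg_le hp _ _) hx0.le).trans (le_of_eq ?_)
    rw [hx, ← Real.mul_rpow (by positivity) (by positivity), div_mul_div_cancel₀ (by positivity),
      div_self (by positivity), Real.one_rpow]
  -- The indicator of the cell attains the norm.
  · set u := hκ.step 𝕜 p (e.code + 1) fun k => if k = 1 then 1 else 0 with hu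
    have h1 : hκ.unitCoef hp e u = (x : 𝕜) := by
      rw [unitCoef, hu, smul_apply, hκ.cellAvg_step hp le_rfl h1k]
      simp [hx]
    have h2 : ‖u‖ = x := by
      refine (Real.rpow_left_inj (norm_nonneg _) hx0.le (by linarith : p.toReal ≠ 0)).1 ?_
      rw [hu, hκ.norm_step_rpow hp0 hp, hx, ← Real.rpow_mul (by positivity),
        inv_mul_cancel₀ (by linarith), Real.rpow_one, levelAvg, mul_div_assoc',
        Finset.sum_eq_single_of_mem 1 (Finset.mem_range.2 h1k)]
      · simp
      · intro k _ hk
        simp [hk, Real.zero_rpow (by linarith : p.toReal ≠ 0)]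
    have h3 := (hκ.unitCoef (𝕜 := 𝕜) hp e).le_opNorm u
    rw [h1, h2, RCLike.norm_ofReal, abs_of_pos hx0] at h3
    exact le_of_mul_le_mul_right (by linarith) hx0

/-- By Jensen each term is at most the integral of ‖f‖^p over its cell, and the cells are pairwise
disjoint. -/
theorem summable_unitCoef_rpow (hp : p ≠ ∞) (f : Lp 𝕜 p μ) :
    Summable fun e : HaarIndex K => ‖hκ.unitCoef hp e f‖ ^ p.toReal := by
  have hr := one_le_toReal (p := p) hp
  have hp0 : p ≠ 0 := (zero_lt_one.trans_le Fact.out).ne'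
  refine summable_of_sum_le (c := ‖f‖ ^ p.toReal) (fun e => by positivity) fun F => ?_
  have h1 : ∀ e : HaarIndex K, ‖hκ.unitCoef hp e f‖ ^ p.toReal ≤
      ∫ x in κ (e.code + 1) ⁻¹' {1}, ‖f x‖ ^ p.toReal ∂μ := fun e => by
    have h2 := hκ.rpow_norm_cellAvg_le hp (e.code + 1) 1 f
    have h0 : 0 ≤ ∫ x in κ (e.code + 1) ⁻¹' {1}, ‖f x‖ ^ p.toReal ∂μ :=
      integral_nonneg fun x => by positivity
    rw [unitCoef, smul_apply, norm_smul, RCLike.norm_ofReal,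
      abs_of_nonneg (by positivity), Real.mul_rpow (by positivity) (norm_nonneg _),
      ← Real.rpow_mul (by positivity), inv_mul_cancel₀ (by linarith), Real.rpow_one,
      cellAvg_apply]
    rcases (measureReal_nonneg (μ := μ) (s := Set.univ)).eq_or_lt with hm | hm
    · simpa [← hm] using h0
    · refine (mul_le_mul_of_nonneg_left h2 (by positivity)).trans (le_of_eq ?_)
      field_simp
  refine (Finset.sum_le_sum fun e _ => h1 e).trans ?_
  rw [← integral_biUnion_finset F (fun e _ => hκ.measurableSet_cell _ _) _
    fun e _ => (integrable_norm_rpow_coe hp0 hp f).integrableOn, norm_rpow_eq_integral hp0 hp]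
  · exact setIntegral_le_integral (integrable_norm_rpow_coe hp0 hp f)
      (Filter.Eventually.of_forall fun x => by positivity)
  -- Index 1 at a deeper level forces index 0 at every earlier positive level; this is why cell 1 is
  -- used rather than cell 0.
  · have key : ∀ (a b : ℕ) (x : α), a < b → κ (a + 1) x = 1 → κ (b + 1) x = 1 → False := by
      intro a b x hab ha hb
      have h2 := hκ.div_two_pow_of_le (by omega : a + 1 ≤ b + 1) x
      rw [ha, hb, Nat.div_eq_of_lt (Nat.one_lt_two_pow (by omega))] at h2
      omega
    intro e _ e' _ hne
    rw [Function.onFun, Set.disjoint_left]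
    intro x hx hx'
    rcases lt_trichotomy e.code e'.code with h | h | h
    · exact key _ _ x h hx hx'
    · exact hne (HaarIndex.code_injective h)
    · exact key _ _ x h hx' hx

theorem summable_unitCoef_sq [NeZero μ] (hp2 : p ≤ 2) (hp : p ≠ ∞) (f : Lp 𝕜 p μ) :
    Summable fun e : HaarIndex K => ‖hκ.unitCoef hp e f‖ ^ 2 := by
  have hr := one_le_toReal (p := p) hp
  have hr2 : p.toReal ≤ 2 := by
    simpa using (ENNReal.toReal_le_toReal hp (by simp)).2 hp2
  refine Summable.of_nonneg_of_le (fun e => by positivity) (fun e => ?_)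
    ((hκ.summable_unitCoef_rpow (K := K) hp f).mul_right (‖f‖ ^ (2 - p.toReal)))
  have h1 : ‖hκ.unitCoef hp e f‖ ≤ ‖f‖ := by
    simpa [hκ.norm_unitCoef hp e] using (hκ.unitCoef (𝕜 := 𝕜) hp e).le_opNorm f
  rcases (norm_nonneg (hκ.unitCoef hp e f)).eq_or_lt with h0 | h0
  · rw [← h0, zero_pow two_ne_zero]
    positivity
  · calc ‖hκ.unitCoef hp e f‖ ^ 2 =
        ‖hκ.unitCoef hp e f‖ ^ p.toReal * ‖hκ.unitCoef hp e f‖ ^ (2 - p.toReal) := by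
          rw [← Real.rpow_add h0, add_sub_cancel, Real.rpow_two]
      _ ≤ _ := by
        refine mul_le_mul_of_nonneg_left (Real.rpow_le_rpow h0.le h1 (by linarith)) (by positivity)

/-- The `K n` copies together contribute the factor 1/(16 `K n`), which is at most the weight
2^(-2n/p) of the cotype 2 estimate `sum_sq_haarCoef_le`. -/
theorem summable_smallCoef_sq [NeZero μ] (hp1 : 1 < p) (hp2 : p ≤ 2) (hp : p ≠ ∞)
    (hK0 : ∀ n, 0 < K n) (hK : ∀ n, ((2 : ℝ) ^ n) ^ (2 / p.toReal) ≤ K n) (f : Lp 𝕜 p μ) :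
    Summable fun e : HaarIndex K => ‖hκ.smallCoef hp e f‖ ^ 2 := by
  obtain ⟨C, -, hC⟩ := hκ.sum_sq_haarCoef_le (𝕜 := 𝕜) hp1 hp2
  refine summable_of_sum_le (c := C * ‖f‖ ^ 2) (fun e => by positivity) fun F => ?_
  obtain ⟨N, hN⟩ := HaarIndex.exists_subset_level F
  refine le_trans ?_ (hC hp f N)
  refine (Finset.sum_le_sum_of_subset_of_nonneg hN fun e _ _ => by positivity).trans ?_
  simp only [smallCoef, smul_apply]
  rw [HaarIndex.sum_level N (fun n i => ‖(4 * (K n : 𝕜))⁻¹ • hκ.haarCoef hp n i f‖ ^ 2)]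
  refine Finset.sum_le_sum fun n _ => Finset.sum_le_sum fun i _ => ?_
  have hK1 : (0 : ℝ) < K n := by exact_mod_cast hK0 n
  rw [norm_smul, norm_inv, norm_mul, RCLike.norm_ofNat, RCLike.norm_natCast, nsmul_eq_mul, mul_pow,
    ← mul_assoc]
  refine mul_le_mul_of_nonneg_right ?_ (by positivity)
  rw [Real.rpow_neg (by positivity)]
  calc (K n : ℝ) * (4 * (K n : ℝ))⁻¹ ^ 2 = 1 / 16 * (1 / K n) := by field_simp; norm_num
    _ ≤ 1 / K n := by
      have : 0 < 1 / (K n : ℝ) := by positivity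
      linarith
    _ ≤ _ := by
      rw [one_div]
      exact inv_anti₀ (by positivity) (hK n)

/-- In a finite partial sum each Haar coefficient is multiplied by (number of copies present)/(4 `K
n`) ≤ 1, so Burkholder bounds all partial sums uniformly. On step functions the series is finite,
and density finishes. -/
theorem hasSum_smallCoef_smul_haar [NeZero μ] (hp1 : 1 < p) (hp2 : p ≤ 2) (hp : p ≠ ∞)
    (hK0 : ∀ n, 0 < K n) (f : Lp 𝕜 p μ) :
    HasSum (fun e : HaarIndex K => hκ.smallCoef hp e f • hκ.haar 𝕜 p e.1 e.2.1)
      ((4 : 𝕜)⁻¹ • (f - hκ.cellAvg hp 0 0 f • hκ.one 𝕜 p)) := by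
  classical
  obtain ⟨C, -, hC⟩ := hκ.norm_haar_transform_le (𝕜 := 𝕜) hp1 hp2
  have hK1 : ∀ n, (K n : 𝕜) ≠ 0 := fun n => by exact_mod_cast (hK0 n).ne'
  obtain ⟨S, hS, hmem⟩ := exists_isClosed_hasSum_submodule
    (fun e : HaarIndex K => (hκ.smallCoef hp e).smulRight (hκ.haar 𝕜 p e.1 e.2.1))
    ((4 : 𝕜)⁻¹ • (ContinuousLinearMap.id 𝕜 (Lp 𝕜 p μ) -
      (hκ.cellAvg hp 0 0).smulRight (hκ.one 𝕜 p))) (C := C) fun F f => by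
    obtain ⟨N, hN⟩ := HaarIndex.exists_subset_level F
    have hFN : ∀ e ∈ F, e.1 < N := fun e he => by simpa using hN he
    simp only [ContinuousLinearMap.smulRight_apply]
    rw [hκ.sum_smul_haar_index F (fun e => hκ.smallCoef hp e f) hFN]
    refine hC hp f (fun l k => ∑ e ∈ F with e.1 = l ∧ (e.2.1 : ℕ) = k, hκ.smallCoef hp e f)
      (fun n i => ?_) N
    rw [Finset.sum_congr rfl (g := fun _ => (4 * (K n : 𝕜))⁻¹ • hκ.haarCoef hp n i f) fun e he => by
      obtain ⟨-, rfl, rfl⟩ := Finset.mem_filter.1 he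
      rfl]
    rw [Finset.sum_const, ← Nat.cast_smul_eq_nsmul 𝕜, smul_smul, norm_smul]
    refine mul_le_of_le_one_left (norm_nonneg _) ?_
    have h1 : ((F.filter fun e => e.1 = n ∧ (e.2.1 : ℕ) = i).card : ℝ) ≤ K n := by
      exact_mod_cast HaarIndex.card_filter_le F n i
    have h2 : (0 : ℝ) < K n := by exact_mod_cast hK0 n
    rw [norm_mul, norm_inv, norm_mul, RCLike.norm_ofNat, RCLike.norm_natCast, RCLike.norm_natCast,
      ← div_eq_mul_inv, div_le_one (by positivity)]
    linarith
  have hf := (hmem f).1 (hκ.dense_step hp S hS (fun M c => (hmem _).2 ?_) f)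
  · simpa using hf
  · set g := hκ.step 𝕜 p M c with hg
    have h1 := hasSum_sum_of_ne_finset_zero (L := .unconditional (HaarIndex K))
      (s := (Finset.range M).sigma fun n => (Finset.univ : Finset (Fin (2 ^ n) × Fin (K n))))
      (f := fun e : HaarIndex K => hκ.smallCoef hp e g • hκ.haar 𝕜 p e.1 e.2.1) fun e he => by
        have hM : M ≤ e.1 := by simpa using he
        rw [smallCoef, smul_apply, hg, hκ.haarCoef_step hp hM e.2.1.2]
        simp
    change HasSum (fun e : HaarIndex K => hκ.smallCoef hp e g • hκ.haar 𝕜 p e.1 e.2.1) _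
    convert h1 using 1
    simp only [smallCoef, smul_apply]
    rw [HaarIndex.sum_level M (fun n i => ((4 * (K n : 𝕜))⁻¹ • hκ.haarCoef hp n i g) •
      hκ.haar 𝕜 p n i)]
    have h2 : ∀ n i, K n • ((4 * (K n : 𝕜))⁻¹ • hκ.haarCoef hp n i g) • hκ.haar 𝕜 p n i =
        (4 : 𝕜)⁻¹ • hκ.haarCoef hp n i g • hκ.haar 𝕜 p n i := fun n i => by
      rw [← Nat.cast_smul_eq_nsmul 𝕜, smul_assoc, smul_smul]
      congr 1
      have := hK1 n
      field_simp
    simp only [h2, ← Finset.smul_sum]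
    rw [hg, hκ.sum_haarCoef_smul_haar_step hp]
    simp

omit [Fact (1 ≤ p)] in
theorem norm_haar_add_noise (e : HaarIndex K) {s : 𝕜} (hs : ‖s‖ = 1) :
    ∀ᵐ x ∂μ, ‖(hκ.haar 𝕜 p e.1 e.2.1 + s • hκ.noise 𝕜 p e : Lp 𝕜 p μ) x‖ = 1 := by
  filter_upwards [Lp.coeFn_add (hκ.haar 𝕜 p e.1 e.2.1) (s • hκ.noise 𝕜 p e),
    Lp.coeFn_smul s (hκ.noise 𝕜 p e), hκ.coeFn_step (p := p) (𝕜 := 𝕜) (e.1 + 1)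
      fun k => if k / 2 = e.2.1 then (-1) ^ k else 0,
    hκ.coeFn_step (p := p) (𝕜 := 𝕜) (e.code + 1) fun k =>
      if k / 2 ^ (e.code + 1 - e.1) = e.2.1 then 0 else (-1) ^ k] with x h1 h2 h3 h4
  have h := e.fst_le_code
  rw [hκ.half] at h3
  rw [hκ.div_two_pow_of_le (by omega)] at h4
  rw [h1, Pi.add_apply, h2, Pi.smul_apply, haar, noise, h3, h4]
  split_ifs <;> simp [hs]

end IsDyadicCoding

/-! ### Combining expansions into the frame of part (i). -/

section Expansion

variable {𝕜 X : Type*} [RCLike 𝕜] [NormedAddCommGroup X] [NormedSpace 𝕜 X]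

/-- The map `S` has an unconditional expansion with vectors in the set `U` and seminormalized
functionals. -/
def HasExpansion (𝕜 : Type*) {X : Type*} [RCLike 𝕜] [NormedAddCommGroup X] [NormedSpace 𝕜 X]
    (U : Set X) (S : X → X) : Prop :=
  ∃ (g : ℕ → X) (g' : ℕ → StrongDual 𝕜 X), (∀ x, HasSum (fun n => g' n x • g n) (S x)) ∧
    (∀ n, g n ∈ U) ∧ IsSeminormalized g'

theorem HasExpansion.add {U : Set X} {S T : X → X} (hS : HasExpansion 𝕜 U S)
    (hT : HasExpansion 𝕜 U T) : HasExpansion 𝕜 U fun x => S x + T x := by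
  obtain ⟨g, g', hg, hgU, A, B, hA, hB, hAB⟩ := hS
  obtain ⟨h, h', hh, hhU, A', B', hA', hB', hAB'⟩ := hT
  refine ⟨fun n => if n % 2 = 0 then g (n / 2) else h (n / 2),
    fun n => if n % 2 = 0 then g' (n / 2) else h' (n / 2), fun x => ?_, fun n => ?_,
    min A A', max B B', lt_min hA hA', lt_max_of_lt_left hB, fun n => ?_⟩
  · have h2 : ∀ k, (2 * k + 1) % 2 = 1 := by omega
    refine HasSum.even_add_odd ?_ ?_
    · simpa using hg x
    · simpa [h2, odd_div_two] using hh x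
  · dsimp only
    split_ifs
    exacts [hgU _, hhU _]
  · dsimp only
    split_ifs
    · exact ⟨(min_le_left _ _).trans (hAB _).1, (hAB _).2.trans (le_max_left _ _)⟩
    · exact ⟨(min_le_right _ _).trans (hAB' _).1, (hAB' _).2.trans (le_max_right _ _)⟩

theorem HasExpansion.cons {U : Set X} {S : X → X} (hS : HasExpansion 𝕜 U S) {u : X} (hu : u ∈ U)
    {u' : StrongDual 𝕜 X} (hu' : u' ≠ 0) : HasExpansion 𝕜 U fun x => S x + u' x • u := by
  obtain ⟨g, g', hg, hgU, A, B, hA, hB, hAB⟩ := hS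
  have hpos : 0 < ‖u'‖ := norm_pos_iff.2 hu'
  refine ⟨fun n => Nat.casesOn n u g, fun n => Nat.casesOn n u' g', fun x => ?_, fun n => ?_,
    min A ‖u'‖, max B ‖u'‖, lt_min hA hpos, lt_max_of_lt_left hB, fun n => ?_⟩
  · have := (hasSum_nat_add_iff (f := fun n => (Nat.casesOn n u' g' : StrongDual 𝕜 X) x •
      (Nat.casesOn n u g : X)) 1).1 (hg x)
    simpa using this
  · cases n
    exacts [hu, hgU _]
  · cases n
    · exact ⟨min_le_right _ _, le_max_right _ _⟩
    · exact ⟨(min_le_left _ _).trans (hAB _).1, (hAB _).2.trans (le_max_left _ _)⟩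

theorem hasExpansion_of_equiv {ι : Type*} (e : ℕ ≃ ι) {U : Set X} {S : X → X} (g : ι → X)
    (g' : ι → StrongDual 𝕜 X) (h : ∀ x, HasSum (fun i => g' i x • g i) (S x)) (hU : ∀ i, g i ∈ U)
    {A B : ℝ} (hA : 0 < A) (hB : 0 < B) (hAB : ∀ i, A ≤ ‖g' i‖ ∧ ‖g' i‖ ≤ B) :
    HasExpansion 𝕜 U S :=
  ⟨g ∘ e, g' ∘ e, fun x => (e.hasSum_iff (f := fun i => g' i x • g i)).2 (h x), fun _ => hU _, A, B,
    hA, hB, fun _ => hAB _⟩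

end Expansion

instance HaarIndex.instInfinite {K : ℕ → ℕ} [hK : ∀ n, NeZero (K n)] : Infinite (HaarIndex K) :=
  Infinite.of_injective (fun n : ℕ => (⟨n, ⟨0, by positivity⟩, 0⟩ : HaarIndex K)) fun n m h => by
    simpa using congrArg Sigma.fst h

/-- The `L^p` space of a nonzero coded measure, `1 < p ≤ 2`, has an unconditional Schauder frame of
unimodular functions with seminormalized functionals. -/
theorem IsDyadicCoding.exists_unimodular_frame {α 𝕜 : Type*} [MeasurableSpace α] [RCLike 𝕜]
    {μ : Measure α} [IsFiniteMeasure μ] [NeZero μ] {κ : ℕ → α → ℕ} (hκ : IsDyadicCoding μ κ)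
    {p : ℝ≥0∞} [Fact (1 ≤ p)] (hp1 : 1 < p) (hp2 : p ≤ 2) :
    ∃ (g : ℕ → Lp 𝕜 p μ) (g' : ℕ → StrongDual 𝕜 (Lp 𝕜 p μ)),
      IsUnconditionalSchauderFrame g g' ∧ IsUnimodularSystem g ∧ IsSeminormalized g' := by
  have hp : p ≠ ∞ := (hp2.trans_lt (by simp)).ne
  have hr1 : 1 < p.toReal := by
    simpa using (ENNReal.toReal_lt_toReal ENNReal.one_ne_top hp).2 hp1
  have hr2 : p.toReal ≤ 2 := by
    simpa using (ENNReal.toReal_le_toReal hp (by simp)).2 hp2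
  have hm : 0 < μ.real Set.univ := measureReal_univ_pos
  obtain ⟨K, hK⟩ := exists_multiplicity hr1 hr2
  have hK0 : ∀ n, 0 < K n := fun n => (hK n).1
  have : ∀ n, NeZero (K n) := fun n => ⟨(hK0 n).ne'⟩
  obtain ⟨e⟩ : Nonempty (ℕ ≃ HaarIndex K) := nonempty_equiv_of_countable
  set U : Set (Lp 𝕜 p μ) := {u | ∀ᵐ x ∂μ, ‖u x‖ = 1} with hU
  set D : ℝ := (2 / μ.real Set.univ) ^ (p.toReal)⁻¹ with hD
  have hD0 : 0 < D := by positivity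
  have hS1 := fun f : Lp 𝕜 p μ => hκ.hasSum_smallCoef_smul_haar hp1 hp2 hp hK0 f
  have hS2 : ∀ f : Lp 𝕜 p μ,
      Summable fun i : HaarIndex K => hκ.smallCoef hp i f • hκ.noise 𝕜 p i := fun f =>
    summable_of_norm_sum_rpow_le (hκ.summable_smallCoef_sq hp1 hp2 hp hK0 (fun n => (hK n).2.2) f)
      measureReal_nonneg (by linarith : 0 < p.toReal / 2) (by linarith : 0 < p.toReal)
      (fun i => by positivity) fun F => hκ.norm_sum_noise_rpow_le hp1.le hp2 F _
  have hS3 : ∀ f : Lp 𝕜 p μ,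
      Summable fun i : HaarIndex K => hκ.unitCoef hp i f • hκ.haar 𝕜 p i.1 i.2.1 := fun f =>
    summable_of_norm_sum_rpow_le (hκ.summable_unitCoef_rpow (K := K) hp f)
      (by positivity : 0 ≤ μ.real Set.univ * 2) one_pos (by linarith : 0 < p.toReal)
      (fun i => by positivity) fun F => by
        rw [Real.rpow_one]
        exact hκ.norm_sum_haar_rpow_le hp1.le hp2 (fun n => (hK n).2.1) F _
  have hS4 : ∀ f : Lp 𝕜 p μ,
      Summable fun i : HaarIndex K => hκ.unitCoef hp i f • hκ.noise 𝕜 p i := fun f =>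
    summable_of_norm_sum_rpow_le (hκ.summable_unitCoef_sq (K := K) hp2 hp f)
      measureReal_nonneg (by linarith : 0 < p.toReal / 2) (by linarith : 0 < p.toReal)
      (fun i => by positivity) fun F => hκ.norm_sum_noise_rpow_le hp1.le hp2 F _
  -- The expanded product: s accompanies the noise, t the unit functional. Convergence of the four
  -- series separately is what permits the cancellation below.
  have hexp : ∀ s t : 𝕜, ‖s‖ = 1 → ‖t‖ = 1 → HasExpansion 𝕜 U fun f =>
      ((4 : 𝕜)⁻¹ • (f - hκ.cellAvg hp 0 0 f • hκ.one 𝕜 p)) +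
      s • (∑' i : HaarIndex K, hκ.smallCoef hp i f • hκ.noise 𝕜 p i) +
      (t * (2 * D : ℝ)) • (∑' i : HaarIndex K, hκ.unitCoef hp i f • hκ.haar 𝕜 p i.1 i.2.1) +
      (t * (2 * D : ℝ) * s) • (∑' i : HaarIndex K, hκ.unitCoef hp i f • hκ.noise 𝕜 p i) := by
    intro s t hs ht
    refine hasExpansion_of_equiv e (fun i => hκ.haar 𝕜 p i.1 i.2.1 + s • hκ.noise 𝕜 p i)
      (fun i => hκ.smallCoef hp i + (t * (2 * D : ℝ)) • hκ.unitCoef hp i) (fun f => ?_)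
      (fun i => hκ.norm_haar_add_noise i hs) hD0 (by positivity : 0 < 3 * D) fun i => ?_
    · refine ((((hS1 f).add ((hS2 f).hasSum.const_smul s)).add
        ((hS3 f).hasSum.const_smul (t * (2 * D : ℝ)))).add
        ((hS4 f).hasSum.const_smul (t * (2 * D : ℝ) * s))).congr_fun fun i => ?_
      simp only [add_apply, smul_apply, smul_eq_mul]
      module
    -- The small functional has norm at most D and the added one exactly 2D, so the sum lies between
    -- D and 3D.
    · have h1 := hκ.norm_smallCoef_le (𝕜 := 𝕜) hp hK0 (fun n => (hK n).2.2) i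
      have h2 : ‖(t * (2 * D : ℝ)) • hκ.unitCoef (𝕜 := 𝕜) hp i‖ = 2 * D := by
        rw [norm_smul, hκ.norm_unitCoef, norm_mul, ht, RCLike.norm_ofReal,
          abs_of_pos (by positivity)]
        ring
      have h3 := norm_add_le (hκ.smallCoef hp i) ((t * (2 * D : ℝ)) • hκ.unitCoef (𝕜 := 𝕜) hp i)
      have h4 := norm_sub_le (hκ.smallCoef hp i + (t * (2 * D : ℝ)) • hκ.unitCoef (𝕜 := 𝕜) hp i)
        (hκ.smallCoef hp i)
      rw [add_sub_cancel_left, h2] at h4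
      rw [h2] at h3
      rw [← hD] at h1
      exact ⟨by linarith, by linarith⟩
  have hone : hκ.one 𝕜 p ∈ U := by
    filter_upwards [hκ.coeFn_step (p := p) (𝕜 := 𝕜) 0 fun _ => 1] with x hx
    rw [one, hx, norm_one]
  have havg : hκ.cellAvg (𝕜 := 𝕜) (p := p) hp 0 0 ≠ 0 := fun h => by
    have h1 := hκ.cellAvg_step (𝕜 := 𝕜) hp le_rfl (by norm_num : 0 < 2 ^ 0) fun _ => 1
    rw [h] at h1
    simp at h1
  have hn1 : ‖(1 : 𝕜)‖ = 1 := norm_one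
  have hn2 : ‖(-1 : 𝕜)‖ = 1 := by rw [norm_neg, norm_one]
  -- Over the four sign pairs the terms carrying s, t or ts cancel, and four quarters give f minus
  -- its mean. The constant function restores the mean.
  obtain ⟨g, g', hg, hgU, hg'⟩ := ((((hexp 1 1 hn1 hn1).add (hexp 1 (-1) hn1 hn2)).add
    (hexp (-1) 1 hn2 hn1)).add (hexp (-1) (-1) hn2 hn2)).cons hone havg
  refine ⟨g, g', fun f => ?_, hgU, hg'⟩
  convert hg f using 1
  module

/-! ### Averages over signs and Khintchine's inequality. -/

section Signs

variable {ι : Type*} [DecidableEq ι]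

/-- The sum of the vectors `c n`, `n ∈ F`, with sign `+` on `S` and sign `-` outside `S`. -/
def signedSum {X : Type*} [AddCommGroup X] (F S : Finset ι) (c : ι → X) : X :=
  ∑ n ∈ F, if n ∈ S then c n else -c n

section AddCommGroup

variable {X : Type*} [AddCommGroup X]

theorem signedSum_insert_left {F S : Finset ι} {a : ι} (ha : a ∉ F) (hS : S ⊆ F) (c : ι → X) :
    signedSum (insert a F) S c = signedSum F S c - c a := by
  have haS : a ∉ S := fun h => ha (hS h)
  rw [signedSum, Finset.sum_insert ha, if_neg haS, signedSum, sub_eq_add_neg, add_comm]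

theorem signedSum_insert_insert {F S : Finset ι} {a : ι} (ha : a ∉ F) (c : ι → X) :
    signedSum (insert a F) (insert a S) c = signedSum F S c + c a := by
  rw [signedSum, Finset.sum_insert ha, if_pos (Finset.mem_insert_self a S), signedSum, add_comm]
  congr 1
  refine Finset.sum_congr rfl fun n hn => ?_
  have hna : n ≠ a := fun h => ha (h ▸ hn)
  simp [Finset.mem_insert, hna]

theorem map_signedSum {Y H : Type*} [AddCommGroup Y] [FunLike H X Y] [AddMonoidHomClass H X Y]
    (φ : H) (F S : Finset ι) (c : ι → X) :
    φ (signedSum F S c) = signedSum F S fun n => φ (c n) := by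
  simp only [signedSum, map_sum]
  refine Finset.sum_congr rfl fun n _ => ?_
  split_ifs <;> simp

theorem sum_powerset_signedSum_insert {M : Type*} [AddCommMonoid M] {F : Finset ι} {a : ι}
    (ha : a ∉ F) (c : ι → X) (Φ : X → M) :
    ∑ S ∈ (insert a F).powerset, Φ (signedSum (insert a F) S c) =
      ∑ S ∈ F.powerset, (Φ (signedSum F S c + c a) + Φ (signedSum F S c - c a)) := by
  rw [Finset.sum_powerset_insert ha, add_comm, ← Finset.sum_add_distrib]
  refine Finset.sum_congr rfl fun S hS => ?_
  rw [signedSum_insert_left ha (Finset.mem_powerset.1 hS), signedSum_insert_insert ha]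

end AddCommGroup

theorem sum_powerset_norm_signedSum_sq {𝕜 : Type*} [RCLike 𝕜] (F : Finset ι) (c : ι → 𝕜) :
    ∑ S ∈ F.powerset, ‖signedSum F S c‖ ^ 2 = 2 ^ F.card * ∑ n ∈ F, ‖c n‖ ^ 2 := by
  induction F using Finset.induction_on with
  | empty => simp [signedSum]
  | insert a F ha ih =>
    rw [sum_powerset_signedSum_insert ha c fun z => ‖z‖ ^ 2]
    simp only [norm_add_sq_add_norm_sub_sq]
    rw [← Finset.mul_sum, Finset.sum_add_distrib, ih, Finset.card_insert_of_notMem ha,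
      Finset.sum_insert ha, Finset.sum_const, Finset.card_powerset, nsmul_eq_mul, pow_succ]
    push_cast
    ring

/-- Each off-diagonal term carries a product of two independent signs and averages to zero. -/
theorem sum_powerset_bilin {𝕜 X : Type*} [RCLike 𝕜] [NormedAddCommGroup X] [NormedSpace 𝕜 X]
    (F : Finset ι) (χ : ι → StrongDual 𝕜 X) (y : ι → X) :
    ∑ S ∈ F.powerset, signedSum F S χ (signedSum F S y) = 2 ^ F.card * ∑ n ∈ F, χ n (y n) := by
  induction F using Finset.induction_on with
  | empty => simp [signedSum]
  | insert a F ha ih =>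
    rw [Finset.sum_powerset_insert ha, ← Finset.sum_add_distrib]
    have h : ∀ S ∈ F.powerset, signedSum (insert a F) S χ (signedSum (insert a F) S y) +
        signedSum (insert a F) (insert a S) χ (signedSum (insert a F) (insert a S) y) =
        2 * signedSum F S χ (signedSum F S y) + 2 * χ a (y a) := fun S hS => by
      rw [signedSum_insert_left ha (Finset.mem_powerset.1 hS),
        signedSum_insert_left ha (Finset.mem_powerset.1 hS), signedSum_insert_insert ha,
        signedSum_insert_insert ha]
      simp only [sub_apply, add_apply, map_sub, map_add]
      ring
    rw [Finset.sum_congr rfl h, Finset.sum_add_distrib, ← Finset.mul_sum, ih,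
      Finset.card_insert_of_notMem ha, Finset.sum_insert ha, Finset.sum_const,
      Finset.card_powerset, nsmul_eq_mul, pow_succ]
    push_cast
    ring

/-- In the addition formulas the sinh terms cancel when the sign of one index is flipped, so the
average factorizes. -/
theorem sum_powerset_cosh (F : Finset ι) (c : ι → ℝ) :
    ∑ S ∈ F.powerset, Real.cosh (signedSum F S c) = 2 ^ F.card * ∏ n ∈ F, Real.cosh (c n) := by
  induction F using Finset.induction_on with
  | empty => simp [signedSum]
  | insert a F ha ih =>
    rw [sum_powerset_signedSum_insert ha c]
    have h : ∀ x : ℝ, Real.cosh (x + c a) + Real.cosh (x - c a) =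
        2 * Real.cosh (c a) * Real.cosh x := fun x => by
      rw [Real.cosh_add, Real.cosh_sub]
      ring
    simp only [h]
    rw [← Finset.mul_sum, ih, Finset.card_insert_of_notMem ha, Finset.prod_insert ha, pow_succ]
    ring

theorem sum_powerset_cosh_le (F : Finset ι) (c : ι → ℝ) :
    ∑ S ∈ F.powerset, Real.cosh (signedSum F S c) ≤
      2 ^ F.card * Real.exp ((∑ n ∈ F, c n ^ 2) / 2) := by
  rw [sum_powerset_cosh, Finset.sum_div, Real.exp_sum]
  gcongr with n
  exact Real.cosh_le_exp_half_sq _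

theorem exp_two_mul_abs_le (x : ℝ) : Real.exp (2 * |x|) ≤ 2 * Real.cosh (2 * x) := by
  rw [← Real.cosh_abs (2 * x), abs_mul, abs_of_pos (two_pos (α := ℝ)), Real.cosh_eq]
  linarith [Real.exp_pos (-(2 * |x|))]

/-- Powers are dominated by the exponential, and exp(|a| + |b|) is split by the inequality between
arithmetic and geometric means. This reduces moments of scalar sums to real exponential moments. -/
theorem rpow_norm_le_cosh {𝕜 : Type*} [RCLike 𝕜] {r : ℝ} (hr : 0 ≤ r) (z : 𝕜) :
    ‖z‖ ^ r ≤ 1 + (⌈r⌉₊.factorial : ℝ) *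
      (Real.cosh (2 * RCLike.re z) + Real.cosh (2 * RCLike.im z)) := by
  set k := ⌈r⌉₊
  have h1 : ‖z‖ ^ r ≤ 1 + ‖z‖ ^ k := by
    rcases le_total ‖z‖ 1 with h | h
    · have := Real.rpow_le_one (norm_nonneg z) h hr
      have : 0 ≤ ‖z‖ ^ k := by positivity
      linarith
    · have := Real.rpow_le_rpow_of_exponent_le h (Nat.le_ceil r)
      rw [Real.rpow_natCast] at this
      linarith
  have h2 : ‖z‖ ^ k ≤ k.factorial * Real.exp ‖z‖ := by
    have := Real.pow_div_factorial_le_exp ‖z‖ (norm_nonneg z) k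
    rwa [div_le_iff₀' (by positivity)] at this
  have h3 : Real.exp ‖z‖ ≤ Real.cosh (2 * RCLike.re z) + Real.cosh (2 * RCLike.im z) := by
    have ha := exp_two_mul_abs_le (RCLike.re z)
    have hb := exp_two_mul_abs_le (RCLike.im z)
    have hn : ‖z‖ ≤ |RCLike.re z| + |RCLike.im z| := by
      refine abs_le_of_sq_le_sq' ?_ (by positivity) |>.2
      rw [RCLike.norm_sq_eq_def, add_sq, sq_abs, sq_abs]
      have : 0 ≤ |RCLike.re z| * |RCLike.im z| := by positivity
      linarith
    have hab := Real.exp_le_exp.2 hn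
    rw [Real.exp_add] at hab
    have ha2 : Real.exp (2 * |RCLike.re z|) = Real.exp |RCLike.re z| ^ 2 := by
      rw [← Real.exp_nat_mul]
      norm_num
    have hb2 : Real.exp (2 * |RCLike.im z|) = Real.exp |RCLike.im z| ^ 2 := by
      rw [← Real.exp_nat_mul]
      norm_num
    nlinarith [sq_nonneg (Real.exp |RCLike.re z| - Real.exp |RCLike.im z|)]
  have h4 := mul_le_mul_of_nonneg_left h3 (by positivity : (0 : ℝ) ≤ k.factorial)
  linarith

/-- **Khintchine's inequality**. -/
theorem khintchine (𝕜 : Type*) [RCLike 𝕜] {r : ℝ} (hr : 0 < r) :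
    ∃ C : ℝ, 0 < C ∧ ∀ (F : Finset ι) (c : ι → 𝕜),
      ∑ S ∈ F.powerset, ‖signedSum F S c‖ ^ r ≤
        2 ^ F.card * (C * (∑ n ∈ F, ‖c n‖ ^ 2) ^ (r / 2)) := by
  set C : ℝ := 1 + (⌈r⌉₊.factorial : ℝ) * (Real.exp 2 + Real.exp 2)
  have hnormal : ∀ (F : Finset ι) (c : ι → 𝕜), ∑ n ∈ F, ‖c n‖ ^ 2 ≤ 1 →
      ∑ S ∈ F.powerset, ‖signedSum F S c‖ ^ r ≤ 2 ^ F.card * C := by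
    intro F c hc
    -- Applied to real and imaginary parts. Doubling the argument multiplies the sum of squares by
    -- 4, hence the bound exp(4/2).
    have key : ∀ φ : 𝕜 →+ ℝ, (∀ z, |φ z| ≤ ‖z‖) →
        ∑ S ∈ F.powerset, Real.cosh (2 * φ (signedSum F S c)) ≤ 2 ^ F.card * Real.exp 2 := by
      intro φ hφ
      have h := sum_powerset_cosh_le F fun n => 2 * φ (c n)
      have h2 : ∀ S, signedSum F S (fun n => 2 * φ (c n)) = 2 * φ (signedSum F S c) := fun S =>
        (map_signedSum ((AddMonoidHom.mulLeft (2 : ℝ)).comp φ) F S c).symm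
      simp only [h2] at h
      refine h.trans ?_
      gcongr
      have h3 : ∑ n ∈ F, (2 * φ (c n)) ^ 2 ≤ ∑ n ∈ F, 4 * ‖c n‖ ^ 2 :=
        Finset.sum_le_sum fun n _ => by
          have := sq_le_sq' (by linarith [neg_le_of_abs_le (hφ (c n))]) (le_of_abs_le (hφ (c n)))
          linarith
      rw [← Finset.mul_sum] at h3
      linarith
    have h1 := key (RCLike.re (K := 𝕜)) RCLike.abs_re_le_norm
    have h2 := key (RCLike.im (K := 𝕜)) RCLike.abs_im_le_norm
    refine (Finset.sum_le_sum fun S _ => rpow_norm_le_cosh hr.le (signedSum F S c)).trans ?_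
    rw [Finset.sum_add_distrib, ← Finset.mul_sum, Finset.sum_add_distrib, Finset.sum_const,
      Finset.card_powerset, nsmul_eq_mul]
    have h3 := mul_le_mul_of_nonneg_left (add_le_add h1 h2)
      (by positivity : (0 : ℝ) ≤ (⌈r⌉₊.factorial : ℝ))
    push_cast
    linarith
  refine ⟨C, by positivity, fun F c => ?_⟩
  set q := ∑ n ∈ F, ‖c n‖ ^ 2 with hq
  have hq0 : 0 ≤ q := Finset.sum_nonneg fun n _ => by positivity
  rcases hq0.eq_or_lt with h0 | h0
  · have hc0 : ∀ n ∈ F, c n = 0 := fun n hn => by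
      have := (Finset.sum_eq_zero_iff_of_nonneg (fun n _ => by positivity)).1 h0.symm n hn
      simpa using this
    have hz : ∀ S, signedSum F S c = 0 := fun S => Finset.sum_eq_zero fun n hn => by
      simp [hc0 n hn]
    simp only [hz, norm_zero, Real.zero_rpow hr.ne', Finset.sum_const_zero]
    positivity
  · have hs : 0 < √q := Real.sqrt_pos.2 h0
    have h := hnormal F (fun n => ((√q : ℝ) : 𝕜)⁻¹ * c n) (by
      simp only [norm_mul, norm_inv, RCLike.norm_ofReal, abs_of_pos hs, mul_pow, inv_pow,
        Real.sq_sqrt hq0, ← Finset.mul_sum, ← hq]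
      rw [inv_mul_cancel₀ h0.ne'])
    have h2 : ∀ S, signedSum F S (fun n => ((√q : ℝ) : 𝕜)⁻¹ * c n) =
        ((√q : ℝ) : 𝕜)⁻¹ * signedSum F S c := fun S =>
      (map_signedSum (AddMonoidHom.mulLeft ((√q : ℝ) : 𝕜)⁻¹) F S c).symm
    simp only [h2, norm_mul, norm_inv, RCLike.norm_ofReal, abs_of_pos hs] at h
    simp only [Real.mul_rpow (inv_nonneg.2 hs.le) (norm_nonneg _), ← Finset.mul_sum] at h
    rw [Real.inv_rpow hs.le, inv_mul_le_iff₀ (by positivity), Real.sqrt_eq_rpow,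
      ← Real.rpow_mul hq0] at h
    refine h.trans (le_of_eq ?_)
    rw [show 1 / 2 * r = r / 2 by ring]
    ring

end Signs

/-! ### Uniform bounds for signed partial sums. -/

section UnconditionalBounds

variable {𝕜 X : Type*} [RCLike 𝕜] [NormedAddCommGroup X] [NormedSpace 𝕜 X]

theorem Summable.exists_norm_sum_le {ι Y : Type*} [DecidableEq ι] [NormedAddCommGroup Y]
    [CompleteSpace Y] {v : ι → Y} (hv : Summable v) : ∃ C, ∀ F : Finset ι, ‖∑ i ∈ F, v i‖ ≤ C := by
  obtain ⟨s, hs⟩ := summable_iff_vanishing_norm.1 hv 1 one_pos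
  refine ⟨∑ i ∈ s, ‖v i‖ + 1, fun F => ?_⟩
  rw [← Finset.sum_inter_add_sum_sdiff F s]
  refine (norm_add_le _ _).trans (add_le_add ((norm_sum_le _ _).trans ?_)
    (hs _ Finset.sdiff_disjoint).le)
  exact Finset.sum_le_sum_of_subset_of_nonneg Finset.inter_subset_right fun i _ _ => norm_nonneg _

/-- The signed partial sums of an unconditional Schauder frame are uniformly bounded. -/
theorem IsUnconditionalSchauderFrame.exists_norm_signedSum_le [CompleteSpace X] {g : ℕ → X}
    {g' : ℕ → StrongDual 𝕜 X} (hg : IsUnconditionalSchauderFrame g g') :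
    ∃ C : ℝ, 0 < C ∧ ∀ (F S : Finset ℕ) (x : X),
      ‖signedSum F S fun n => g' n x • g n‖ ≤ C * ‖x‖ := by
  set T : Finset ℕ × Finset ℕ → X →L[𝕜] X := fun FS =>
    signedSum FS.1 FS.2 fun n => (g' n).smulRight (g n) with hT
  have hTx : ∀ FS x, T FS x = signedSum FS.1 FS.2 fun n => g' n x • g n := fun FS x =>
    map_signedSum (ContinuousLinearMap.apply 𝕜 X x) FS.1 FS.2 _
  obtain ⟨C, hC⟩ := banach_steinhaus (g := T) fun x => by
    obtain ⟨C, hC⟩ := (hg x).summable.exists_norm_sum_le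
    refine ⟨C + C, fun FS => ?_⟩
    -- A signed sum is the difference of two subset sums, each bounded by C.
    rw [hTx, signedSum, Finset.sum_ite]
    refine (norm_add_le _ _).trans (add_le_add (hC _) ?_)
    rw [Finset.sum_neg_distrib, norm_neg]
    exact hC _
  refine ⟨|C| + 1, by positivity, fun F S x => ?_⟩
  have h := (T (F, S)).le_of_opNorm_le ((hC (F, S)).trans (le_abs_self C)) x
  rw [hTx] at h
  nlinarith [norm_nonneg x]

end UnconditionalBounds

/-! ### Square summability of coefficients and dual coefficients for p > 2. -/

section LpBounds

variable {α 𝕜 : Type*} [MeasurableSpace α] [RCLike 𝕜] {μ : Measure α} [IsFiniteMeasure μ]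
  {p : ℝ≥0∞}

omit [IsFiniteMeasure μ] in
theorem coeFn_signedSum_smul (F S : Finset ℕ) (c : ℕ → 𝕜) (f : ℕ → Lp 𝕜 p μ) :
    (signedSum F S fun n => c n • f n : Lp 𝕜 p μ) =ᵐ[μ]
      fun x => signedSum F S fun n => c n * f n x := by
  unfold signedSum
  induction F using Finset.induction_on with
  | empty =>
    simp only [Finset.sum_empty]
    exact Lp.coeFn_zero 𝕜 p μ
  | insert a F ha ih =>
    simp only [Finset.sum_insert ha]
    filter_upwards [Lp.coeFn_add (if a ∈ S then c a • f a else -(c a • f a))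
      (∑ n ∈ F, if n ∈ S then c n • f n else -(c n • f n)), ih, Lp.coeFn_smul (c a) (f a),
      Lp.coeFn_neg (c a • f a)] with x h1 h2 h3 h4
    rw [h1, Pi.add_apply, h2]
    congr 1
    split_ifs
    · rw [h3]
      rfl
    · rw [h4, Pi.neg_apply, h3]
      rfl

theorem two_lt_toReal (hp2 : 2 < p) (hp : p ≠ ∞) : 2 < p.toReal := by
  simpa using (ENNReal.toReal_lt_toReal (by simp) hp).2 hp2

theorem integrable_norm_sq_coe (hp2 : 2 < p) (f : Lp 𝕜 p μ) :
    Integrable (fun x => ‖f x‖ ^ 2) μ :=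
  ((Lp.memLp f).mono_exponent hp2.le).integrable_norm_pow two_ne_zero

/-- Bounded functions that are bounded below in `L^p` are bounded below in `L^2`. -/
theorem exists_le_integral_norm_sq [Fact (1 ≤ p)] (hp2 : 2 < p) (hp : p ≠ ∞) {g : ℕ → Lp 𝕜 p μ}
    (hb : IsUniformlyBoundedSystem g) (hs : IsSeminormalized g) :
    ∃ δ : ℝ, 0 < δ ∧ ∀ n, δ ≤ ∫ x, ‖g n x‖ ^ 2 ∂μ := by
  have hr := two_lt_toReal hp2 hp
  obtain ⟨M, hM⟩ := hb
  obtain ⟨A, B, hA, -, hAB⟩ := hs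
  set M' := max M 1
  have hM' : 0 < M' := lt_max_of_lt_right one_pos
  refine ⟨A ^ p.toReal / M' ^ (p.toReal - 2), by positivity, fun n => ?_⟩
  rw [div_le_iff₀' (by positivity)]
  refine (Real.rpow_le_rpow hA.le (hAB n).1 (by linarith)).trans ?_
  rw [norm_rpow_eq_integral (by positivity) hp, ← integral_const_mul]
  refine integral_mono_ae (integrable_norm_rpow_coe (by positivity) hp _)
    ((integrable_norm_sq_coe hp2 _).const_mul _) ?_
  filter_upwards [hM n] with x hx
  have h1 : ‖g n x‖ ≤ M' := hx.trans (le_max_left _ _)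
  rcases (norm_nonneg (g n x)).eq_or_lt with h0 | h0
  · rw [← h0, Real.zero_rpow (by linarith)]
    positivity
  · calc ‖g n x‖ ^ p.toReal = ‖g n x‖ ^ (p.toReal - 2) * ‖g n x‖ ^ 2 := by
          rw [← Real.rpow_two, ← Real.rpow_add h0, sub_add_cancel]
      _ ≤ _ := by
          refine mul_le_mul_of_nonneg_right (Real.rpow_le_rpow h0.le h1 (by linarith))
            (by positivity)

/-- The coefficients of an unconditional frame of uniformly bounded seminormalized functions in
`L^p`, `p > 2`, are square summable. -/
theorem exists_sum_norm_coef_sq_le [Fact (1 ≤ p)] (hp2 : 2 < p) (hp : p ≠ ∞) {g : ℕ → Lp 𝕜 p μ}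
    {g' : ℕ → StrongDual 𝕜 (Lp 𝕜 p μ)} (hg : IsUnconditionalSchauderFrame g g')
    (hb : IsUniformlyBoundedSystem g) (hs : IsSeminormalized g) :
    ∃ C : ℝ, 0 < C ∧ ∀ (F : Finset ℕ) (f : Lp 𝕜 p μ), ∑ n ∈ F, ‖g' n f‖ ^ 2 ≤ C * ‖f‖ ^ 2 := by
  have hr := two_lt_toReal hp2 hp
  obtain ⟨δ, hδ, hgδ⟩ := exists_le_integral_norm_sq hp2 hp hb hs
  obtain ⟨K, hK, hKg⟩ := hg.exists_norm_signedSum_le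
  have hm : 0 ≤ μ.real Set.univ := measureReal_nonneg
  have hunit : ∀ (F : Finset ℕ) (f : Lp 𝕜 p μ), K * ‖f‖ ≤ 1 →
      ∑ n ∈ F, ‖g' n f‖ ^ 2 ≤ (μ.real Set.univ + 1) / δ := by
    intro F f hf
    -- Signed sums have L^p norm at most 1 here, and |z|² ≤ 1 + |z|^p pointwise gives an L² bound.
    have h1 : ∀ S : Finset ℕ,
        ∫ x, ‖signedSum F S fun n => g' n f * g n x‖ ^ 2 ∂μ ≤ μ.real Set.univ + 1 := fun S => by
      set Z : Lp 𝕜 p μ := signedSum F S fun n => g' n f • g n with hZ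
      have hZ1 : ‖Z‖ ^ p.toReal ≤ 1 :=
        Real.rpow_le_one (norm_nonneg _) ((hKg F S f).trans hf) (by linarith)
      rw [norm_rpow_eq_integral (by positivity) hp] at hZ1
      calc ∫ x, ‖signedSum F S fun n => g' n f * g n x‖ ^ 2 ∂μ = ∫ x, ‖Z x‖ ^ 2 ∂μ := by
            refine integral_congr_ae ?_
            filter_upwards [coeFn_signedSum_smul F S (fun n => g' n f) g] with x hx
            rw [hZ, hx]
        _ ≤ ∫ x, (1 + ‖Z x‖ ^ p.toReal) ∂μ := by
            refine integral_mono (integrable_norm_sq_coe hp2 _) ((integrable_const _).add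
              (integrable_norm_rpow_coe (by positivity) hp _)) fun x => ?_
            dsimp only
            rcases le_total ‖Z x‖ 1 with h | h
            · have : ‖Z x‖ ^ 2 ≤ 1 := pow_le_one₀ (norm_nonneg _) h
              have : 0 ≤ ‖Z x‖ ^ p.toReal := by positivity
              linarith
            · have := Real.rpow_le_rpow_of_exponent_le h hr.le
              rw [Real.rpow_two] at this
              linarith
        _ ≤ _ := by
            rw [integral_add (integrable_const _)
              (integrable_norm_rpow_coe (by positivity) hp _), integral_const, smul_eq_mul, mul_one]
            linarith
    have h2 : ∑ S ∈ F.powerset, ∫ x, ‖signedSum F S fun n => g' n f * g n x‖ ^ 2 ∂μ =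
        2 ^ F.card * ∑ n ∈ F, ‖g' n f‖ ^ 2 * ∫ x, ‖g n x‖ ^ 2 ∂μ := by
      rw [← integral_finsetSum]
      · simp only [sum_powerset_norm_signedSum_sq, norm_mul, mul_pow]
        rw [integral_const_mul, integral_finsetSum _ fun n _ =>
          (integrable_norm_sq_coe hp2 _).const_mul _]
        simp only [integral_const_mul]
      · intro S _
        refine (integrable_norm_sq_coe hp2 (signedSum F S fun n => g' n f • g n)).congr ?_
        filter_upwards [coeFn_signedSum_smul F S (fun n => g' n f) g] with x hx
        rw [hx]
    have h3 := Finset.sum_le_sum fun S (_ : S ∈ F.powerset) => h1 S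
    rw [h2, Finset.sum_const, Finset.card_powerset, nsmul_eq_mul] at h3
    push_cast at h3
    have h4 := le_of_mul_le_mul_left h3 (by positivity)
    rw [le_div_iff₀ hδ, Finset.sum_mul]
    refine le_trans (Finset.sum_le_sum fun n _ => ?_) h4
    exact mul_le_mul_of_nonneg_left (hgδ n) (by positivity)
  refine ⟨(μ.real Set.univ + 1) / δ * K ^ 2, by positivity, fun F f => ?_⟩
  rcases eq_or_ne f 0 with rfl | hf
  · simp
  have hf0 : 0 < ‖f‖ := norm_pos_iff.2 hf
  have h := hunit F (((K * ‖f‖ : ℝ) : 𝕜)⁻¹ • f) (by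
    rw [norm_smul, norm_inv, RCLike.norm_ofReal, abs_of_pos (by positivity)]
    field_simp
    exact le_rfl)
  simp only [map_smul, norm_smul, norm_inv, RCLike.norm_ofReal, mul_pow, ← Finset.mul_sum] at h
  rw [abs_of_pos (by positivity), inv_pow, inv_mul_le_iff₀ (by positivity)] at h
  refine h.trans (le_of_eq ?_)
  ring

omit [IsFiniteMeasure μ] in
/-- The space `L^p`, `p > 2`, has type two. -/
theorem exists_sum_norm_signedSum_le [Fact (1 ≤ p)] (hp2 : 2 < p) (hp : p ≠ ∞) :
    ∃ C : ℝ, 0 < C ∧ ∀ (F : Finset ℕ) (a : ℕ → 𝕜) (f : ℕ → Lp 𝕜 p μ), (∀ n, ‖f n‖ ≤ 1) →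
      ∑ n ∈ F, ‖a n‖ ^ 2 = 1 →
      ∑ S ∈ F.powerset, ‖signedSum F S fun n => a n • f n‖ ≤ 2 ^ F.card * C := by
  have hr := two_lt_toReal hp2 hp
  obtain ⟨C, hC, hkh⟩ := khintchine (ι := ℕ) 𝕜 (by linarith : 0 < p.toReal)
  refine ⟨1 + C, by positivity, fun F a f hf ha => ?_⟩
  have hint : ∀ n, Integrable (fun x => ‖f n x‖ ^ p.toReal) μ := fun n =>
    integrable_norm_rpow_coe (by positivity) hp _
  have h1 : ∑ S ∈ F.powerset, ‖signedSum F S fun n => a n • f n‖ ^ p.toReal ≤ 2 ^ F.card * C := by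
    calc ∑ S ∈ F.powerset, ‖signedSum F S fun n => a n • f n‖ ^ p.toReal
        = ∑ S ∈ F.powerset, ∫ x, ‖signedSum F S fun n => a n * f n x‖ ^ p.toReal ∂μ := by
          refine Finset.sum_congr rfl fun S _ => ?_
          rw [norm_rpow_eq_integral (by positivity) hp]
          refine integral_congr_ae ?_
          filter_upwards [coeFn_signedSum_smul F S a f] with x hx
          rw [hx]
      _ = ∫ x, ∑ S ∈ F.powerset, ‖signedSum F S fun n => a n * f n x‖ ^ p.toReal ∂μ := by
          rw [integral_finsetSum]
          intro S _
          refine (integrable_norm_rpow_coe (by positivity) hp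
            (signedSum F S fun n => a n • f n)).congr ?_
          filter_upwards [coeFn_signedSum_smul F S a f] with x hx
          rw [hx]
      _ ≤ ∫ x, 2 ^ F.card * (C * ∑ n ∈ F, ‖a n‖ ^ 2 * ‖f n x‖ ^ p.toReal) ∂μ := by
          refine integral_mono_of_nonneg (Filter.Eventually.of_forall fun x =>
            Finset.sum_nonneg fun S _ => by positivity)
            (((integrable_finsetSum _ fun n _ => (hint n).const_mul _).const_mul _).const_mul _)
            (Filter.Eventually.of_forall fun x => ?_)
          refine (hkh F fun n => a n * f n x).trans
            (mul_le_mul_of_nonneg_left (mul_le_mul_of_nonneg_left ?_ hC.le) (by positivity))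
          -- The ‖a n‖² sum to one, so convexity of t^(p/2) with these weights replaces the triangle
          -- inequality in L^(p/2).
          have h := Real.rpow_arith_mean_le_arith_mean_rpow F (fun n => ‖a n‖ ^ 2)
            (fun n => ‖f n x‖ ^ 2) (fun n _ => by positivity) ha (fun n _ => by positivity)
            (p := p.toReal / 2) (by linarith)
          simp only [norm_mul, mul_pow]
          refine h.trans (le_of_eq (Finset.sum_congr rfl fun n _ => ?_))
          rw [← Real.rpow_two ‖f n x‖, ← Real.rpow_mul (norm_nonneg (f n x)),
            mul_div_cancel₀ _ two_ne_zero]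
      _ = 2 ^ F.card * (C * ∑ n ∈ F, ‖a n‖ ^ 2 * ‖f n‖ ^ p.toReal) := by
          rw [integral_const_mul, integral_const_mul, integral_finsetSum _ fun n _ =>
            (hint n).const_mul _]
          simp only [integral_const_mul, norm_rpow_eq_integral (by positivity : p ≠ 0) hp]
      _ ≤ 2 ^ F.card * (C * ∑ n ∈ F, ‖a n‖ ^ 2) := by
          gcongr with n
          exact mul_le_of_le_one_right (by positivity)
            (Real.rpow_le_one (norm_nonneg _) (hf n) (by linarith))
      _ = _ := by rw [ha, mul_one]
  calc ∑ S ∈ F.powerset, ‖signedSum F S fun n => a n • f n‖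
      ≤ ∑ S ∈ F.powerset, (1 + ‖signedSum F S fun n => a n • f n‖ ^ p.toReal) := by
        refine Finset.sum_le_sum fun S _ => ?_
        rcases le_total ‖signedSum F S fun n => a n • f n‖ 1 with h | h
        · have : 0 ≤ ‖signedSum F S fun n => a n • f n‖ ^ p.toReal := by positivity
          linarith
        · have := Real.rpow_le_rpow_of_exponent_le h (by linarith : 1 ≤ p.toReal)
          rw [Real.rpow_one] at this
          linarith
    _ ≤ _ := by
        rw [Finset.sum_add_distrib, Finset.sum_const, Finset.card_powerset, nsmul_eq_mul]
        push_cast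
        linarith

/-- If the functionals of an unconditional frame in `L^p`, `p > 2`, are bounded below, then the
dual coefficients are square summable. -/
theorem exists_sum_norm_apply_sq_le [Fact (1 ≤ p)] (hp2 : 2 < p) (hp : p ≠ ∞) {g : ℕ → Lp 𝕜 p μ}
    {g' : ℕ → StrongDual 𝕜 (Lp 𝕜 p μ)} (hg : IsUnconditionalSchauderFrame g g') {c : ℝ}
    (hc : 0 < c) (hcg : ∀ n, c ≤ ‖g' n‖) :
    ∃ C : ℝ, 0 < C ∧ ∀ (F : Finset ℕ) (h : StrongDual 𝕜 (Lp 𝕜 p μ)),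
      ∑ n ∈ F, ‖h (g n)‖ ^ 2 ≤ C * ‖h‖ ^ 2 := by
  obtain ⟨K, hK, hKg⟩ := hg.exists_norm_signedSum_le
  obtain ⟨C, hC, htype⟩ := exists_sum_norm_signedSum_le (𝕜 := 𝕜) (μ := μ) hp2 hp
  -- The norm of `g' n` need not be known to be attained; half of the lower bound c leaves room.
  have hnorming : ∀ n, ∃ f : Lp 𝕜 p μ, ‖f‖ ≤ 1 ∧ g' n f = ((c / 2 : ℝ) : 𝕜) := fun n => by
    obtain ⟨x, hx1, hx⟩ := (g' n).exists_lt_apply_of_lt_opNorm (r := c / 2) (by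
      linarith [hcg n])
    have h0 : 0 < ‖g' n x‖ := by linarith
    refine ⟨(((c / 2 : ℝ) : 𝕜) / g' n x) • x, ?_, ?_⟩
    · rw [norm_smul, norm_div, RCLike.norm_ofReal, abs_of_pos (by positivity)]
      exact mul_le_one₀ ((div_le_one h0).2 hx.le) (norm_nonneg _) hx1.le
    · rw [map_smul, smul_eq_mul, div_mul_cancel₀ _ (norm_pos_iff.1 h0)]
  choose f hf1 hf using hnorming
  refine ⟨(2 * K * C / c) ^ 2, by positivity, fun F h => ?_⟩
  set q := ∑ n ∈ F, ‖h (g n)‖ ^ 2 with hq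
  have hq0 : 0 ≤ q := Finset.sum_nonneg fun n _ => by positivity
  rcases hq0.eq_or_lt with h0 | h0
  · rw [← h0]
    positivity
  have hs : 0 < √q := Real.sqrt_pos.2 h0
  set a : ℕ → 𝕜 := fun n => ((√q : ℝ) : 𝕜)⁻¹ * (starRingEnd 𝕜) (h (g n)) with ha
  have ha1 : ∑ n ∈ F, ‖a n‖ ^ 2 = 1 := by
    simp only [ha, norm_mul, norm_inv, RCLike.norm_ofReal, abs_of_pos hs, mul_pow, inv_pow,
      Real.sq_sqrt hq0, ← Finset.mul_sum, RCLike.norm_conj, ← hq]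
    rw [inv_mul_cancel₀ h0.ne']
  -- For signs ε and y = ∑ ε_m a_m f_m, the average of h(∑ ε_n g'_n(y) g_n) keeps only the diagonal,
  -- which equals √q·c/2 by the choice of a. Unconditionality and type 2 bound the same average from
  -- above.
  have hbil := sum_powerset_bilin F (fun n => h (g n) • g' n) fun n => a n • f n
  have hdiag : ∑ n ∈ F, (h (g n) • g' n) (a n • f n) = ((√q * (c / 2) : ℝ) : 𝕜) := by
    have h1 : ∀ n, (h (g n) • g' n) (a n • f n) =
        (((√q)⁻¹ * (c / 2) * ‖h (g n)‖ ^ 2 : ℝ) : 𝕜) := fun n => by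
      rw [smul_apply, map_smul, hf, ha, smul_eq_mul, smul_eq_mul]
      have := RCLike.mul_conj (h (g n))
      push_cast
      rw [← this]
      ring
    rw [Finset.sum_congr rfl fun n _ => h1 n, ← RCLike.ofReal_sum, ← Finset.mul_sum, ← hq]
    congr 1
    have := Real.mul_self_sqrt hq0
    field_simp
    linarith
  rw [hdiag] at hbil
  have hle : ∀ S, ‖signedSum F S (fun n => h (g n) • g' n) (signedSum F S fun n => a n • f n)‖ ≤
      ‖h‖ * K * ‖signedSum F S fun n => a n • f n‖ := fun S => by
    set y := signedSum F S fun n => a n • f n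
    have h1 : signedSum F S (fun n => h (g n) • g' n) y =
        h (signedSum F S fun n => g' n y • g n) := by
      refine (map_signedSum (ContinuousLinearMap.apply 𝕜 𝕜 y) F S _).trans
        ((congrArg _ (funext fun n => ?_)).trans (map_signedSum h F S _).symm)
      simp [mul_comm]
    rw [h1, mul_assoc]
    exact (h.le_opNorm _).trans (mul_le_mul_of_nonneg_left (hKg F S y) (norm_nonneg _))
  have hfin : 2 ^ F.card * (√q * (c / 2)) ≤ ‖h‖ * K * (2 ^ F.card * C) := by
    calc 2 ^ F.card * (√q * (c / 2)) = ‖(2 ^ F.card * ((√q * (c / 2) : ℝ) : 𝕜) : 𝕜)‖ := by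
          rw [norm_mul, norm_pow, RCLike.norm_ofNat, RCLike.norm_ofReal, abs_of_pos (by positivity)]
      _ ≤ ∑ S ∈ F.powerset, ‖h‖ * K * ‖signedSum F S fun n => a n • f n‖ := by
          rw [← hbil]
          exact (norm_sum_le _ _).trans (Finset.sum_le_sum fun S _ => hle S)
      _ ≤ _ := by
          rw [← Finset.mul_sum]
          exact mul_le_mul_of_nonneg_left (htype F a f hf1 ha1) (by positivity)
  have hfin2 : √q ≤ 2 * K * C / c * ‖h‖ := by
    have h2 : 2 ^ F.card * (√q * (c / 2)) ≤ 2 ^ F.card * (‖h‖ * K * C) := by linarith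
    have h3 := le_of_mul_le_mul_left h2 (by positivity)
    rw [div_mul_eq_mul_div, le_div_iff₀ hc]
    linarith
  calc q = √q ^ 2 := (Real.sq_sqrt hq0).symm
    _ ≤ (2 * K * C / c * ‖h‖) ^ 2 := by gcongr
    _ = _ := by ring

end LpBounds

/-! ### The contradiction with Hilbert space structure, and the theorem. -/

/-- A space with an unconditional frame whose coefficients and dual coefficients are square
summable is isomorphic to a Hilbert space. -/
theorem IsUnconditionalSchauderFrame.norm_sq_le_tsum {𝕜 X : Type*} [RCLike 𝕜]
    [NormedAddCommGroup X] [NormedSpace 𝕜 X] {g : ℕ → X} {g' : ℕ → StrongDual 𝕜 X}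
    (hg : IsUnconditionalSchauderFrame g g') {C : ℝ} (hC0 : 0 ≤ C)
    (hC : ∀ (F : Finset ℕ) (h : StrongDual 𝕜 X), ∑ n ∈ F, ‖h (g n)‖ ^ 2 ≤ C * ‖h‖ ^ 2) {x : X}
    (hx : Summable fun n => ‖g' n x‖ ^ 2) : ‖x‖ ^ 2 ≤ C * ∑' n, ‖g' n x‖ ^ 2 := by
  -- A norming functional is applied to the expansion, followed by Cauchy–Schwarz.
  obtain ⟨h, hh1, hh⟩ := exists_dual_vector'' 𝕜 x
  have hlim := ((h.hasSum (hg x)).norm.pow 2)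
  rw [hh, RCLike.norm_ofReal, abs_norm] at hlim
  refine le_of_tendsto hlim (Filter.Eventually.of_forall fun F => ?_)
  have h1 : ‖∑ n ∈ F, h (g' n x • g n)‖ ≤ ∑ n ∈ F, ‖g' n x‖ * ‖h (g n)‖ := by
    refine (norm_sum_le _ _).trans (le_of_eq (Finset.sum_congr rfl fun n _ => ?_))
    rw [map_smul, norm_smul]
  have h2 : ∑ n ∈ F, ‖h (g n)‖ ^ 2 ≤ C :=
    (hC F h).trans (mul_le_of_le_one_right hC0 (pow_le_one₀ (norm_nonneg _) hh1))
  calc ‖∑ n ∈ F, h (g' n x • g n)‖ ^ 2 ≤ (∑ n ∈ F, ‖g' n x‖ * ‖h (g n)‖) ^ 2 := by gcongr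
    _ ≤ (∑ n ∈ F, ‖g' n x‖ ^ 2) * ∑ n ∈ F, ‖h (g n)‖ ^ 2 := Finset.sum_mul_sq_le_sq_mul_sq _ _ _
    _ ≤ (∑' n, ‖g' n x‖ ^ 2) * C := by
        refine mul_le_mul (hx.sum_le_tsum F fun n _ => by positivity) h2
          (Finset.sum_nonneg fun n _ => by positivity) (tsum_nonneg fun n => by positivity)
    _ = _ := mul_comm _ _

/-- The functionals of an unconditional frame of uniformly bounded seminormalized functions in
`L^p`, `p > 2`, are not bounded below. -/
theorem IsDyadicCoding.exists_norm_coef_lt {α 𝕜 : Type*} [MeasurableSpace α] [RCLike 𝕜]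
    {μ : Measure α} [IsFiniteMeasure μ] [NeZero μ] {κ : ℕ → α → ℕ} (hκ : IsDyadicCoding μ κ)
    {p : ℝ≥0∞} [Fact (1 ≤ p)] (hp2 : 2 < p) (hp : p ≠ ∞) {g : ℕ → Lp 𝕜 p μ}
    {g' : ℕ → StrongDual 𝕜 (Lp 𝕜 p μ)} (hg : IsUnconditionalSchauderFrame g g')
    (hb : IsUniformlyBoundedSystem g) (hs : IsSeminormalized g) {c : ℝ} (hc : 0 < c) :
    ∃ n, ‖g' n‖ < c := by
  by_contra! hcg
  have hr := two_lt_toReal hp2 hp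
  have hm : 0 < μ.real Set.univ := measureReal_univ_pos
  obtain ⟨A, hA, hAg⟩ := exists_sum_norm_coef_sq_le hp2 hp hg hb hs
  obtain ⟨B, hB, hBg⟩ := exists_sum_norm_apply_sq_le hp2 hp hg hc hcg
  have hsum : ∀ f : Lp 𝕜 p μ, Summable fun n => ‖g' n f‖ ^ 2 := fun f =>
    summable_of_sum_le (fun n => by positivity) fun F => hAg F f
  set t := μ.real Set.univ ^ (2 / p.toReal) with ht
  have ht0 : 0 < t := by positivity
  have key : ∀ N : ℕ, ((2 : ℝ) ^ N) ^ (1 - 2 / p.toReal) ≤ B * A := by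
    intro N
    have hpow : ∀ (f : Lp 𝕜 p μ) (x : ℝ), 0 ≤ x → ‖f‖ ^ p.toReal = x →
        ‖f‖ ^ 2 = x ^ (2 / p.toReal) := fun f x _ hfx => by
      rw [← hfx, ← Real.rpow_mul (norm_nonneg f), mul_div_cancel₀ _ (by linarith), Real.rpow_two]
    -- Indicators of the 2^N cells. Every signed sum of them is unimodular, with norm independent of
    -- N, while their squared norms add up to 2^(N(1 - 2/p)) times a constant.
    set u : ℕ → Lp 𝕜 p μ := fun k => hκ.step 𝕜 p N (Pi.single k 1) with hu
    have hu2 : ∀ k < 2 ^ N, ‖u k‖ ^ 2 = (μ.real Set.univ / 2 ^ N) ^ (2 / p.toReal) := by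
      intro k hk
      refine hpow _ _ (by positivity) ?_
      rw [hu, hκ.norm_step_rpow (by positivity) hp, levelAvg, mul_div_assoc',
        Finset.sum_eq_single_of_mem k (Finset.mem_range.2 hk)]
      · simp
      · intro j _ hj
        simp [Pi.single_eq_of_ne hj, Real.zero_rpow (by linarith : p.toReal ≠ 0)]
    have hsigned : ∀ S : Finset ℕ, ‖signedSum (Finset.range (2 ^ N)) S u‖ ^ 2 = t := by
      intro S
      refine hpow _ _ hm.le ?_
      rw [hu, ← map_signedSum, hκ.norm_step_rpow (by positivity) hp, levelAvg, mul_div_assoc']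
      have h1 : ∀ k ∈ Finset.range (2 ^ N), ‖signedSum (Finset.range (2 ^ N)) S
          (fun j => (Pi.single j 1 : ℕ → 𝕜)) k‖ ^ p.toReal = 1 := by
        intro k hk
        rw [signedSum, Finset.sum_apply, Finset.sum_eq_single_of_mem k hk]
        · split_ifs <;> simp
        · intro j _ hj
          split_ifs <;> simp [Pi.single_eq_of_ne hj.symm]
      rw [Finset.sum_congr rfl h1]
      simp
    -- The coefficient bound for the signed sums, averaged over signs, separates the cells.
    have hfin : ∀ F : Finset ℕ, ∑ n ∈ F, ∑ k ∈ Finset.range (2 ^ N), ‖g' n (u k)‖ ^ 2 ≤ A * t := by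
      intro F
      have h1 := Finset.sum_le_sum fun S (_ : S ∈ (Finset.range (2 ^ N)).powerset) =>
        hAg F (signedSum (Finset.range (2 ^ N)) S u)
      simp only [hsigned, map_signedSum] at h1
      rw [Finset.sum_comm, Finset.sum_const, Finset.card_powerset, nsmul_eq_mul] at h1
      simp only [sum_powerset_norm_signedSum_sq, ← Finset.mul_sum] at h1
      push_cast at h1
      exact le_of_mul_le_mul_left h1 (by positivity)
    have hle : ∑ k ∈ Finset.range (2 ^ N), ‖u k‖ ^ 2 ≤ B * (A * t) := by
      calc ∑ k ∈ Finset.range (2 ^ N), ‖u k‖ ^ 2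
          ≤ ∑ k ∈ Finset.range (2 ^ N), B * ∑' n, ‖g' n (u k)‖ ^ 2 :=
            Finset.sum_le_sum fun k _ => hg.norm_sq_le_tsum hB.le hBg (hsum _)
        _ = B * ∑' n, ∑ k ∈ Finset.range (2 ^ N), ‖g' n (u k)‖ ^ 2 := by
            rw [← Finset.mul_sum, Summable.tsum_finsetSum fun k _ => hsum _]
        _ ≤ _ := by
            refine mul_le_mul_of_nonneg_left ?_ hB.le
            exact Real.tsum_le_of_sum_le (fun n => Finset.sum_nonneg fun k _ => by positivity) hfin
    rw [Finset.sum_congr rfl fun k hk => hu2 k (Finset.mem_range.1 hk), Finset.sum_const,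
      Finset.card_range, nsmul_eq_mul, Real.div_rpow hm.le (by positivity), ← ht] at hle
    push_cast at hle
    rw [Real.rpow_sub (by positivity), Real.rpow_one]
    have h2 : (2 : ℝ) ^ N * (t / ((2 : ℝ) ^ N) ^ (2 / p.toReal)) =
      t * (2 ^ N / ((2 : ℝ) ^ N) ^ (2 / p.toReal)) := by ring
    rw [h2, show B * (A * t) = t * (B * A) by ring] at hle
    exact le_of_mul_le_mul_left hle ht0
  have hexp : 0 < 1 - 2 / p.toReal := by
    rw [sub_pos, div_lt_one (by linarith)]
    exact hr
  have hlim : Filter.Tendsto (fun N : ℕ => ((2 : ℝ) ^ N) ^ (1 - 2 / p.toReal)) Filter.atTop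
      Filter.atTop :=
    (tendsto_rpow_atTop hexp).comp (tendsto_pow_atTop_atTop_of_one_lt one_lt_two)
  obtain ⟨N, hN⟩ := (hlim.eventually_gt_atTop (B * A)).exists
  exact absurd (key N) (not_le.2 hN)

theorem theorem1p3 {𝕜 : Type*} [RCLike 𝕜] {d : ℕ} (hd : 0 < d)
    (Ω : Set (EuclideanSpace ℝ (Fin d))) (hΩ : NullMeasurableSet Ω volume)
    (hΩ_pos : 0 < volume Ω) (hΩ_fin : volume Ω < ∞)
    (p : ℝ≥0∞) [Fact (1 ≤ p)] :
    (1 < p → p ≤ 2 →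
      ∃ (g : ℕ → Lp 𝕜 p (volume.restrict Ω))
        (g' : ℕ → StrongDual 𝕜 (Lp 𝕜 p (volume.restrict Ω))),
        IsUnconditionalSchauderFrame g g' ∧ IsUnimodularSystem g ∧ IsSeminormalized g') ∧
    (2 < p → p < ∞ →
      ∀ (g : ℕ → Lp 𝕜 p (volume.restrict Ω))
        (g' : ℕ → StrongDual 𝕜 (Lp 𝕜 p (volume.restrict Ω))),
        IsUnconditionalSchauderFrame g g' → IsUniformlyBoundedSystem g → IsSeminormalized g →
          (⨅ n, ‖g' n‖) = 0 ∧ ¬ IsSeminormalized g') := by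
  have : Nonempty (Fin d) := ⟨⟨0, hd⟩⟩
  have : IsFiniteMeasure (volume.restrict Ω) := ⟨by simpa using hΩ_fin⟩
  have hne : volume.restrict Ω ≠ 0 := by simpa using hΩ_pos.ne'
  have : NeZero (volume.restrict Ω) := ⟨hne⟩
  obtain ⟨κ, hκ⟩ := exists_isDyadicCoding (volume.restrict Ω) hne
  refine ⟨fun hp1 hp2 => hκ.exists_unimodular_frame hp1 hp2, ?_⟩
  intro hp2 hp g g' hg hb hs
  have hlt : ∀ c : ℝ, 0 < c → ∃ n, ‖g' n‖ < c := fun c hc =>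
    hκ.exists_norm_coef_lt hp2 hp.ne hg hb hs hc
  constructor
  · refine le_antisymm (le_of_forall_pos_lt_add fun c hc => ?_)
      (Real.iInf_nonneg fun n => norm_nonneg _)
    obtain ⟨n, hn⟩ := hlt c hc
    rw [zero_add]
    exact (ciInf_le ⟨0, by rintro _ ⟨n, rfl⟩; exact norm_nonneg _⟩ n).trans_lt hn
  · rintro ⟨A, B, hA, -, hAB⟩
    obtain ⟨n, hn⟩ := hlt A hA
    exact absurd (hAB n).1 (not_le.2 hn)
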